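/- Let $A\in\mathbb R^{m\times n}$, $b\in\mathbb R^m$, $k\ge 1$; $\|\cdot\|$ is the 2-norm of vectors and matrices, $\kappa(M)=\|M\|\|M^{-1}\|$. An arithmetic with roundoff unit $v$ is one in which every operation $+,-,*,/,\sqrt{\ }$ and every rounding of a number to the format returns the exact result with a relative error of at most $v$. The mixed-precision LSQR algorithm is the following. (i) In an arithmetic with roundoff unit $\mathbf u$, the Lanczos bidiagonalization with full reorthogonalization (LBFRO) is performed: $\beta_1=\|b\|$, $p_1=b/\beta_1$, $\alpha_1=\|A^Tp_1\|$, $q_1=A^Tp_1/\alpha_1$, and for $j\ge1$, $s_j=Aq_j-\alpha_jp_j$, reorthogonalized against $p_1,\dots,p_j$, $\beta_{j+1}=\|s_j\|$, $p_{j+1}=s_j/\beta_{j+1}$, and $r_j=A^Tp_{j+1}-\beta_{j+1}q_j$, reorthogonalized against $q_1,\dots,q_j$, $\alpha_{j+1}=\|r_j\|$, $q_{j+1}=r_j/\alpha_{j+1}$. Inner products are accumulated sequentially, and each reorthogonalization consists of $N\ge1$ modified Gram–Schmidt sweeps. (ii) In double precision (roundoff unit $2^{-53}$), starting from $\bar\rho_1=\alpha_1$,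 $\bar\phi_1=\beta_1$: $\rho_i=(\bar\rho_i^2+\beta_{i+1}^2)^{1/2}$, $c_i=\bar\rho_i/\rho_i$, $s_i=\beta_{i+1}/\rho_i$, $\theta_{i+1}=s_i\alpha_{i+1}$, $\bar\rho_{i+1}=-c_i\alpha_{i+1}$, $\phi_i=c_i\bar\phi_i$, $\bar\phi_{i+1}=s_i\bar\phi_i$. (iii) In an arithmetic with roundoff unit $\bar{\mathbf u}$, starting from $x_0=0$, $w_1=q_1$: $x_i=x_{i-1}+(\phi_i/\rho_i)w_i$, $w_{i+1}=q_{i+1}-(\theta_{i+1}/\rho_i)w_i$ (with the $q_i$ rounded to this format). Let $\hat x_k$ be the computed $k$-th iterate, and let $x_k$ be the iterate obtained when (i) and (ii) are executed as above but the recurrences (iii) are evaluated exactly. Let $\widehat R_k\in\mathbb R^{k\times k}$ be the unit upper bidiagonal matrix with superdiagonal entries $\theta_{i+1}/\rho_i$, formed from the computed $\theta_{i+1}$, $\rho_i$; it is the computed $R$-factor of the lower bidiagonal $B_k\in\mathbb R^{(k+1)\times k}$ with diagonal entries $\alpha_i$ and subdiagonal entries $\beta_{i+1}$, scaled from the left by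 the inverse of its diagonal. (a) Suppose that the LBFRO in exact arithmetic does not terminate before it has produced $q_k$, i.e. its coefficients $\alpha_1,\beta_1,\dots,\alpha_k,\beta_k$ are nonzero. Then $x_k\neq0$ and $$\frac{\|\hat x_k-x_k\|}{\|x_k\|}\le\sqrt k\,\bigl[1+(2+2\sqrt k+k)\,\kappa(\widehat R_k)\bigr]\bar{\mathbf u}+\mathcal O(\bar{\mathbf u}^2+\bar{\mathbf u}\mathbf u),$$ that is, there are $C,\varepsilon>0$, which depend only on $A,b,k,N$ and not on the roundoff units or the individual rounding errors, such that whenever $\mathbf u,\bar{\mathbf u}\le\varepsilon$ the inequality holds with $C(\bar{\mathbf u}^2+\bar{\mathbf u}\mathbf u)$ in place of the last term. (b) For given $n,k,c,K$, the constants $C,\varepsilon>0$ can be chosen uniformly (for all $m$, $A\in\mathbb R^{m\times n}$, $b\in\mathbb R^m$, $N\ge 1$) over all executions in which the computed coefficients $\alpha_1,\beta_1,\dots,\alpha_k,\beta_k$ are nonzero, $\kappa(\widehat R_k)\le K$, and the orthogonality level of $Q_k=(q_1,\dots,q_k)$, the norm of the strictly upper triangular part of $I-Q_k^TQ_k$,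 is at most $c\,\mathbf u$. -/

import Mathlib

open scoped Matrix

noncomputable section

namespace MixedLSQR

/-- The standard model of floating point arithmetic with roundoff unit `u`:
`fl (a op b) = (a op b) (1 + ε)` with `|ε| ≤ u` for `+`, `-`, `*`, `/`, and likewise for the square
root and for rounding a number to the format. -/
structure FloatArith (u : ℝ) where
  rnd : ℝ → ℝ
  add : ℝ → ℝ → ℝ
  sub : ℝ → ℝ → ℝ
  mul : ℝ → ℝ → ℝ
  div : ℝ → ℝ → ℝ
  sqrt : ℝ → ℝ
  rnd_err : ∀ a, |rnd a - a| ≤ u * |a|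
  add_err : ∀ a b, |add a b - (a + b)| ≤ u * |a + b|
  sub_err : ∀ a b, |sub a b - (a - b)| ≤ u * |a - b|
  mul_err : ∀ a b, |mul a b - a * b| ≤ u * |a * b|
  div_err : ∀ a b, b ≠ 0 → |div a b - a / b| ≤ u * |a / b|
  sqrt_err : ∀ a, 0 ≤ a → |sqrt a - √a| ≤ u * √a

/-- Exact real arithmetic. -/
def exactArith : FloatArith 0 where
  rnd a := a
  add a b := a + b
  sub a b := a - b
  mul a b := a * b
  div a b := a / b
  sqrt a := √a
  rnd_err a := by simp
  add_err a b := by simp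
  sub_err a b := by simp
  mul_err a b := by simp
  div_err a b _ := by simp
  sqrt_err a _ := by simp

/-- The computed inner product `xᵀ y`, accumulated from left to right. -/
def flDot {u : ℝ} (F : FloatArith u) {d : ℕ} (x y : Fin d → ℝ) : ℝ :=
  Fin.foldl d (fun s i => F.add s (F.mul (x i) (y i))) 0

/-- The computed matrix-vector product `M x`. -/
def flMulVec {u : ℝ} (F : FloatArith u) {d e : ℕ} (M : Matrix (Fin d) (Fin e) ℝ)
    (x : Fin e → ℝ) : Fin d → ℝ :=
  fun i => flDot F (M i) x

/-- The computed 2-norm `‖x‖`. -/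
def flNorm {u : ℝ} (F : FloatArith u) {d : ℕ} (x : Fin d → ℝ) : ℝ :=
  F.sqrt (flDot F x x)

/-- The computed vector `x / c`. -/
def flDivScalar {u : ℝ} (F : FloatArith u) {d : ℕ} (x : Fin d → ℝ) (c : ℝ) : Fin d → ℝ :=
  fun i => F.div (x i) c

/-- The computed vector `x - c y`. -/
def flSubSmul {u : ℝ} (F : FloatArith u) {d : ℕ} (x : Fin d → ℝ) (c : ℝ) (y : Fin d → ℝ) :
    Fin d → ℝ :=
  fun i => F.sub (x i) (F.mul c (y i))

/-- One computed sweep of reorthogonalization of `r` against the vectors of the list `vs`, where the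
last vector of the list is used first: `r ← r - (vᵀ r) v` for each `v`. -/
def flSweep {u : ℝ} (F : FloatArith u) {d : ℕ} (vs : List (Fin d → ℝ)) (r : Fin d → ℝ) :
    Fin d → ℝ :=
  vs.foldr (fun v r => flSubSmul F r (flDot F v r) v) r

/-- The quantities `p_i, q_i, α_i, β_i` of the Lanczos bidiagonalization, together with the lists
`[p_i, …, p_1]` and `[q_i, …, q_1]`. -/
structure LanczosState (m n : ℕ) where
  p : Fin m → ℝ
  q : Fin n → ℝ
  α : ℝ
  β : ℝ
  ps : List (Fin m → ℝ)
  qs : List (Fin n → ℝ)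

/-- Start: `β₁ = ‖b‖`, `p₁ = b / β₁`, `α₁ = ‖Aᵀ p₁‖`, `q₁ = Aᵀ p₁ / α₁`. -/
def lbfroInit {u : ℝ} (F : FloatArith u) {m n : ℕ} (A : Matrix (Fin m) (Fin n) ℝ)
    (b : Fin m → ℝ) : LanczosState m n :=
  let β := flNorm F b
  let p := flDivScalar F b β
  let r := flMulVec F Aᵀ p
  let α := flNorm F r
  let q := flDivScalar F r α
  ⟨p, q, α, β, [p], [q]⟩

/-- One step: `s = A q_j - α_j p_j` is reorthogonalized against `p_1, …, p_j`, then
`β_{j+1} = ‖s‖`, `p_{j+1} = s / β_{j+1}`; `r = Aᵀ p_{j+1} - β_{j+1} q_j` is reorthogonalized against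
`q_1, …, q_j`, then `α_{j+1} = ‖r‖`, `q_{j+1} = r / α_{j+1}`. Each reorthogonalization consists of
`N` sweeps. -/
def lbfroStep {u : ℝ} (F : FloatArith u) {m n : ℕ} (A : Matrix (Fin m) (Fin n) ℝ) (N : ℕ)
    (S : LanczosState m n) : LanczosState m n :=
  let s := (flSweep F S.ps)^[N] (flSubSmul F (flMulVec F A S.q) S.α S.p)
  let β := flNorm F s
  let p := flDivScalar F s β
  let r := (flSweep F S.qs)^[N] (flSubSmul F (flMulVec F Aᵀ p) β S.q)
  let α := flNorm F r
  let q := flDivScalar F r α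
  ⟨p, q, α, β, p :: S.ps, q :: S.qs⟩

/-- Lanczos bidiagonalization of `A` with starting vector `b` and full reorthogonalization (LBFRO),
executed in the arithmetic `F`. Indices start at zero: `lbfro F A b N j` holds
`p_{j+1}, q_{j+1}, α_{j+1}, β_{j+1}`. -/
def lbfro {u : ℝ} (F : FloatArith u) {m n : ℕ} (A : Matrix (Fin m) (Fin n) ℝ)
    (b : Fin m → ℝ) (N : ℕ) : ℕ → LanczosState m n
  | 0 => lbfroInit F A b
  | j + 1 => lbfroStep F A N (lbfro F A b N j)

/-- The first `k` (computed) coefficients `α_1, β_1, …, α_k, β_k` are nonzero. -/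
def NoBreakdown {u : ℝ} (F : FloatArith u) {m n : ℕ} (A : Matrix (Fin m) (Fin n) ℝ)
    (b : Fin m → ℝ) (N k : ℕ) : Prop :=
  ∀ j < k, (lbfro F A b N j).α ≠ 0 ∧ (lbfro F A b N j).β ≠ 0

/-- The Givens QR factorization of `(B_k, β₁ e₁)`, executed in the arithmetic `D` from the
sequences `α`, `β` (`α j` is `α_{j+1}`, `β j` is `β_{j+1}`):
`givens D α β j` holds `(ρ̄_{j+1}, φ̄_{j+1})`. -/
def givens {v : ℝ} (D : FloatArith v) (α β : ℕ → ℝ) : ℕ → ℝ × ℝ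
  | 0 => (α 0, β 0)
  | j + 1 =>
    let ρbar := (givens D α β j).1
    let φbar := (givens D α β j).2
    let ρ := D.sqrt (D.add (D.mul ρbar ρbar) (D.mul (β (j + 1)) (β (j + 1))))
    let c := D.div ρbar ρ
    let s := D.div (β (j + 1)) ρ
    (D.mul (-c) (α (j + 1)), D.mul s φbar)

/-- `ρ_{j+1} = (ρ̄_{j+1}² + β_{j+2}²)^{1/2}`. -/
def givensRho {v : ℝ} (D : FloatArith v) (α β : ℕ → ℝ) (j : ℕ) : ℝ :=
  let ρbar := (givens D α β j).1
  D.sqrt (D.add (D.mul ρbar ρbar) (D.mul (β (j + 1)) (β (j + 1))))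

/-- `θ_{j+2} = s_{j+1} α_{j+2}` with `s_{j+1} = β_{j+2} / ρ_{j+1}`. -/
def givensTheta {v : ℝ} (D : FloatArith v) (α β : ℕ → ℝ) (j : ℕ) : ℝ :=
  D.mul (D.div (β (j + 1)) (givensRho D α β j)) (α (j + 1))

/-- `φ_{j+1} = c_{j+1} φ̄_{j+1}` with `c_{j+1} = ρ̄_{j+1} / ρ_{j+1}`. -/
def givensPhi {v : ℝ} (D : FloatArith v) (α β : ℕ → ℝ) (j : ℕ) : ℝ :=
  D.mul (D.div (givens D α β j).1 (givensRho D α β j)) (givens D α β j).2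

/-- The recurrence `w_1 = q_1`, `w_{i+1} = q_{i+1} - (θ_{i+1} / ρ_i) w_i` in the arithmetic `G`
(zero-based: `updW … j` is `w_{j+1}`); the `q_i` are rounded to the format of `G`. -/
def updW {w : ℝ} (G : FloatArith w) {n : ℕ} (q : ℕ → Fin n → ℝ) (ρ θ : ℕ → ℝ) :
    ℕ → Fin n → ℝ
  | 0 => fun a => G.rnd (q 0 a)
  | j + 1 => fun a =>
      G.sub (G.rnd (q (j + 1) a)) (G.mul (G.div (θ j) (ρ j)) (updW G q ρ θ j a))

/-- The recurrence `x_0 = 0`, `x_i = x_{i-1} + (φ_i / ρ_i) w_i` in the arithmetic `G`. -/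
def updX {w : ℝ} (G : FloatArith w) {n : ℕ} (q : ℕ → Fin n → ℝ) (ρ θ φ : ℕ → ℝ) :
    ℕ → Fin n → ℝ
  | 0 => fun _ => 0
  | j + 1 => fun a =>
      G.add (updX G q ρ θ φ j a) (G.mul (G.div (φ j) (ρ j)) (updW G q ρ θ j a))

/-- The `k`-th iterate of mixed-precision LSQR, with the LBFRO (`N` reorthogonalization sweeps)
executed in `F`, the Givens QR factorization in `D` and the recurrences for `x_i`, `w_{i+1}`
in `G`. -/
def iterate {u v w : ℝ} (F : FloatArith u) (D : FloatArith v) (G : FloatArith w) {m n : ℕ}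
    (A : Matrix (Fin m) (Fin n) ℝ) (b : Fin m → ℝ) (N k : ℕ) : EuclideanSpace ℝ (Fin n) :=
  let α : ℕ → ℝ := fun j => (lbfro F A b N j).α
  let β : ℕ → ℝ := fun j => (lbfro F A b N j).β
  WithLp.toLp 2 (updX G (fun j => (lbfro F A b N j).q)
    (givensRho D α β) (givensTheta D α β) (givensPhi D α β) k)

/-- The matrix `R̂_k = D_k⁻¹ R_k`, with unit diagonal and superdiagonal entries `θ_{i+1} / ρ_i`,
formed from the computed quantities. -/
def scaledR {u v : ℝ} (F : FloatArith u) (D : FloatArith v) {m n : ℕ}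
    (A : Matrix (Fin m) (Fin n) ℝ) (b : Fin m → ℝ) (N k : ℕ) : Matrix (Fin k) (Fin k) ℝ :=
  let α : ℕ → ℝ := fun j => (lbfro F A b N j).α
  let β : ℕ → ℝ := fun j => (lbfro F A b N j).β
  Matrix.of fun i j =>
    if i = j then 1
    else if (i : ℕ) + 1 = j then givensTheta D α β i / givensRho D α β i
    else 0

/-- The spectral norm of a square matrix. -/
def specNorm {k : ℕ} (M : Matrix (Fin k) (Fin k) ℝ) : ℝ :=
  ‖Matrix.toEuclideanCLM (𝕜 := ℝ) M‖

/-- The condition number `κ(M) = ‖M‖ ‖M⁻¹‖` in the spectral norm. -/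
def cond {k : ℕ} (M : Matrix (Fin k) (Fin k) ℝ) : ℝ :=
  specNorm M * specNorm M⁻¹

/-- The orthogonality level `ν_k = ‖SUT (I - Q_kᵀ Q_k)‖` of the computed vectors `q_1, …, q_k`,
where `SUT` is the strictly upper triangular part. -/
def orthLevel {u : ℝ} (F : FloatArith u) {m n : ℕ} (A : Matrix (Fin m) (Fin n) ℝ)
    (b : Fin m → ℝ) (N k : ℕ) : ℝ :=
  let Q : Matrix (Fin n) (Fin k) ℝ := Matrix.of fun a j => (lbfro F A b N j).q a
  specNorm (Matrix.of fun i j : Fin k =>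
    if i < j then ((1 : Matrix (Fin k) (Fin k) ℝ) - Qᵀ * Q) i j else 0)

/-- The bound `‖x̂ - x‖ / ‖x‖ ≤ √k (1 + (2 + 2 √k + k) κ) ū + C (ū² + ū u)`, with `x ≠ 0`. -/
def UpdateErrorBound {n : ℕ} (xhat x : EuclideanSpace ℝ (Fin n)) (k : ℕ) (κ u ubar C : ℝ) : Prop :=
  x ≠ 0 ∧ ‖xhat - x‖ / ‖x‖ ≤
    √(k : ℝ) * (1 + (2 + 2 * √(k : ℝ) + (k : ℝ)) * κ) * ubar + C * (ubar ^ 2 + ubar * u)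

end MixedLSQR

end

/-!
The exact iterate is `x = W y`, where the columns of `W` satisfy `W R̂ = Q` and
`y_j = φ_j / ρ_j`. With `z = R̂⁻¹ y` this reads `x = Q z`. As the `q_j` are orthonormal up to `O(u)`,
`‖z‖` equals `‖x‖` up to a factor `1 + O(u)` (`norm_le_of_near_orthonormal`), and `x ≠ 0`, because
`y_1 ≠ 0`.

The recurrences executed in the low precision are solved exactly by the computed vectors up to local
errors: `Ŵ R̂ = Q + E` and `x̂_j - x̂_{j-1} = y_j ŵ_j + g_j`. Hence
`x̂ - x = (Ŵ - W) y + ∑ g_j = E z + ∑ g_j` (`sub_eq_sum_local_errors`, `sum_mulVec_bidiag_smul`).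
To first order `‖e_j‖ ≤ ū (‖q_j‖ + ‖w_j‖ + 2 |t_{j-1}| ‖w_{j-1}‖)`, where the `t_i` are the
superdiagonal entries of `R̂`, and `‖g_j‖ ≤ ū (‖x_j‖ + 2 |y_j| ‖w_j‖)`. All of these are
controlled by `‖W‖_F ≤ ‖R̂⁻¹‖ ‖Q‖_F`, with `‖Q‖_F ≈ √k`, and by `‖y‖ ≤ ‖R̂‖ ‖z‖`: the roundings of
the `q_j` contribute `√k`, the remaining parts of the `e_j` contribute `2 k κ`, the products `y_j w_j`
contribute `2 √k κ`, and the additions contribute `k √k κ`. Every term is homogeneous in `z`, and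
`‖R̂‖, ‖R̂⁻¹‖ ≥ 1`, so that the constants of the second-order terms depend only on `k`, on the bound
for `κ` and on the near orthonormality of the `q_j` (`exists_updateErrorBound`). Near
orthonormality follows from the orthogonality level and from the fact that a computed normalized
vector has norm `1 + O(u)` with a constant depending only on the dimension
(`exists_abs_dotProduct_normalized_sub_one_le`).

For a fixed problem it remains to bound the orthogonality level and `κ`. If the exact coefficients do
not vanish, the computed Lanczos quantities differ from the exact ones by `O(u)`
(`nearState_lbfro`), and the exact `q_j` are orthonormal, because a single exact sweep already
orthogonalizes (`dotProduct_q_exact`). The superdiagonal entries of `R̂` are at most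
`36 α_{j+1} / β_{j+1}` in modulus (for the zero-based coefficients), whatever the errors of the
double precision arithmetic, and bounded entries bound `κ` by compactness (`exists_cond_bidiag_le`).
-/

noncomputable section

namespace MixedLSQR

/-! ### Floating point arithmetics and Euclidean norms of componentwise errors -/

lemma FloatArith.nonneg {u : ℝ} (F : FloatArith u) : 0 ≤ u := by
  have h := (abs_nonneg _).trans (F.rnd_err 1)
  simpa using h

lemma norm_toLp_le_of_abs_le {n : ℕ} {x y : Fin n → ℝ} {c : ℝ} (hc : 0 ≤ c)
    (h : ∀ a, |x a| ≤ c * |y a|) : ‖WithLp.toLp 2 x‖ ≤ c * ‖WithLp.toLp 2 y‖ := by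
  rw [EuclideanSpace.norm_eq, EuclideanSpace.norm_eq]
  refine (Real.sqrt_le_left (by positivity)).2 ?_
  rw [mul_pow, Real.sq_sqrt (by positivity), Finset.mul_sum]
  refine Finset.sum_le_sum fun a _ => ?_
  rw [← mul_pow]
  exact pow_le_pow_left₀ (abs_nonneg _) (h a) 2

/-- The computed product `(a / b) v`, with computed quotient, has relative error `2 u + u²`. -/
lemma norm_mul_div_sub_le {u : ℝ} (G : FloatArith u) {n : ℕ} (v : Fin n → ℝ) {a b : ℝ}
    (hb : b ≠ 0) :
    ‖WithLp.toLp 2 (fun i => G.mul (G.div a b) (v i)) - (a / b) • WithLp.toLp 2 v‖ ≤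
      (2 * u + u ^ 2) * (|a / b| * ‖WithLp.toLp 2 v‖) := by
  have hu := G.nonneg
  have hd := G.div_err a b hb
  rw [← WithLp.toLp_smul, ← WithLp.toLp_sub, ← mul_assoc]
  refine norm_toLp_le_of_abs_le (by positivity) fun i => ?_
  have hm := G.mul_err (G.div a b) (v i)
  have h1 : |G.div a b| ≤ (1 + u) * |a / b| := by
    have := abs_add_le (G.div a b - a / b) (a / b)
    rw [sub_add_cancel] at this
    linarith
  have h2 : |G.div a b * v i - a / b * v i| ≤ u * |a / b| * |v i| := by
    rw [← sub_mul, abs_mul]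
    exact mul_le_mul_of_nonneg_right hd (abs_nonneg _)
  have h3 : u * |G.div a b * v i| ≤ u * ((1 + u) * |a / b| * |v i|) := by
    rw [abs_mul]
    exact mul_le_mul_of_nonneg_left (mul_le_mul_of_nonneg_right h1 (abs_nonneg _)) hu
  have h4 := abs_sub_le (G.mul (G.div a b) (v i)) (G.div a b * v i) (a / b * v i)
  simp only [Pi.sub_apply, Pi.smul_apply, smul_eq_mul]
  linarith

lemma norm_rnd_sub_le {u : ℝ} (G : FloatArith u) {n : ℕ} (v : Fin n → ℝ) :
    ‖WithLp.toLp 2 (fun i => G.rnd (v i)) - WithLp.toLp 2 v‖ ≤ u * ‖WithLp.toLp 2 v‖ := by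
  rw [← WithLp.toLp_sub]
  exact norm_toLp_le_of_abs_le G.nonneg fun i => G.rnd_err (v i)

lemma norm_sub_sub_le {u : ℝ} (G : FloatArith u) {n : ℕ} (v w : Fin n → ℝ) :
    ‖WithLp.toLp 2 (fun i => G.sub (v i) (w i)) - (WithLp.toLp 2 v - WithLp.toLp 2 w)‖ ≤
      u * ‖WithLp.toLp 2 v - WithLp.toLp 2 w‖ := by
  rw [← WithLp.toLp_sub, ← WithLp.toLp_sub]
  exact norm_toLp_le_of_abs_le G.nonneg fun i => G.sub_err (v i) (w i)

lemma norm_add_sub_le {u : ℝ} (G : FloatArith u) {n : ℕ} (v w : Fin n → ℝ) :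
    ‖WithLp.toLp 2 (fun i => G.add (v i) (w i)) - (WithLp.toLp 2 v + WithLp.toLp 2 w)‖ ≤
      u * ‖WithLp.toLp 2 v + WithLp.toLp 2 w‖ := by
  rw [← WithLp.toLp_add, ← WithLp.toLp_sub]
  exact norm_toLp_le_of_abs_le G.nonneg fun i => G.add_err (v i) (w i)

/-! ### Local errors of the update recurrences -/

section Recurrences

variable {E : Type*} [NormedAddCommGroup E] [NormedSpace ℝ E]

lemma norm_smul_computed_le {m w wh : E} {t u B T C : ℝ} (hu : 0 ≤ u) (hu1 : u ≤ 1)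
    (hT : 0 ≤ T) (hC : 0 ≤ C) (ht : |t| ≤ T) (hw : ‖w‖ ≤ B) (hd : ‖wh - w‖ ≤ C * u)
    (hm : ‖m - t • wh‖ ≤ (2 * u + u ^ 2) * (|t| * ‖wh‖)) :
    ‖m - t • wh‖ ≤ 2 * u * (|t| * ‖w‖) + T * (3 * C + B) * u ^ 2 ∧
      ‖m - t • w‖ ≤ T * (3 * B + 4 * C) * u := by
  have h1 : ‖wh‖ ≤ ‖w‖ + C * u := by
    have := norm_add_le (wh - w) w
    rw [sub_add_cancel] at this
    linarith
  have hCu : C * u ≤ C := mul_le_of_le_one_right hC hu1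
  have huu : u ^ 2 ≤ u := by nlinarith
  have h2 : |t| * ‖wh‖ ≤ |t| * ‖w‖ + T * (C * u) := by
    calc |t| * ‖wh‖ ≤ |t| * (‖w‖ + C * u) := mul_le_mul_of_nonneg_left h1 (abs_nonneg _)
      _ ≤ |t| * ‖w‖ + T * (C * u) := by
        rw [mul_add]; gcongr
  have h3 : |t| * ‖w‖ ≤ T * B := mul_le_mul ht hw (norm_nonneg _) hT
  have hTC : 0 ≤ T * C := mul_nonneg hT hC
  have h4 : |t| * ‖wh‖ ≤ T * (B + C) := by
    have : T * (C * u) ≤ T * C := mul_le_mul_of_nonneg_left hCu hT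
    linarith
  have h5 : ‖m - t • wh‖ ≤ 2 * u * (|t| * ‖w‖) + T * (3 * C + B) * u ^ 2 := by
    have a1 : 2 * u * (|t| * ‖wh‖) ≤ 2 * u * (|t| * ‖w‖ + T * (C * u)) := by gcongr
    have a2 : u ^ 2 * (|t| * ‖wh‖) ≤ u ^ 2 * (T * (B + C)) := by gcongr
    linarith
  refine ⟨h5, ?_⟩
  have h6 : ‖m - t • wh‖ ≤ 3 * u * (T * (B + C)) := by
    refine hm.trans (mul_le_mul (by linarith) h4 (by positivity) (by positivity))
  have h7 : ‖t • (wh - w)‖ ≤ T * (C * u) := by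
    rw [norm_smul]
    exact mul_le_mul ht hd (norm_nonneg _) hT
  have h8 : m - t • w = (m - t • wh) + t • (wh - w) := by rw [smul_sub]; abel
  rw [h8]
  have := norm_add_le (m - t • wh) (t • (wh - w))
  linarith

/-- One step of `w' = q' - t w` in floating point arithmetic: `rq` is the rounded `q'`, `m` the
computed `t w`. The local error is bounded to first order in terms of the exact quantities. -/
lemma updW_step_error {q' rq m w wh w' wh' : E} {t u B C : ℝ} (hu : 0 ≤ u) (hu1 : u ≤ 1)
    (hB : 0 ≤ B) (hC : 0 ≤ C) (ht : |t| ≤ B) (hq : ‖q'‖ ≤ B) (hw : ‖w‖ ≤ B) (hw' : ‖w'‖ ≤ B)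
    (hrec : w' = q' - t • w) (h1 : ‖rq - q'‖ ≤ u * ‖q'‖)
    (h2 : ‖m - t • wh‖ ≤ (2 * u + u ^ 2) * (|t| * ‖wh‖))
    (h3 : ‖wh' - (rq - m)‖ ≤ u * ‖rq - m‖) (hd : ‖wh - w‖ ≤ C * u) :
    ‖wh' - w'‖ ≤ (B + 2 * (B + B * (3 * B + 4 * C))) * u ∧
      ‖wh' + t • wh - q'‖ ≤ u * (‖q'‖ + ‖w'‖ + 2 * (|t| * ‖w‖)) +
        (B + 2 * (B * (3 * B + 4 * C))) * u ^ 2 := by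
  obtain ⟨a1, a2⟩ := norm_smul_computed_le hu hu1 hB hC ht hw hd h2
  set M := B * (3 * B + 4 * C) with hM
  have hM0 : 0 ≤ M := by positivity
  have b1 : u * ‖q'‖ ≤ B * u := by nlinarith
  have b2 : ‖(rq - m) - w'‖ ≤ (B + M) * u := by
    have e : (rq - m) - w' = (rq - q') - (m - t • w) := by rw [hrec]; abel
    rw [e]
    have := norm_sub_le (rq - q') (m - t • w)
    linarith
  have b3 : ‖rq - m‖ ≤ ‖w'‖ + (B + M) * u := by
    have := norm_add_le ((rq - m) - w') w'
    rw [sub_add_cancel] at this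
    linarith
  have b4 : u * ‖rq - m‖ ≤ u * (‖w'‖ + (B + M) * u) := mul_le_mul_of_nonneg_left b3 hu
  constructor
  · have e : wh' - w' = (wh' - (rq - m)) + ((rq - m) - w') := by abel
    have := norm_add_le (wh' - (rq - m)) ((rq - m) - w')
    rw [← e] at this
    have c1 : u * ‖w'‖ ≤ u * B := mul_le_mul_of_nonneg_left hw' hu
    have c2 : u * ((B + M) * u) ≤ (B + M) * u := by
      have : 0 ≤ (B + M) * u := by positivity
      nlinarith
    linarith
  · have e : wh' + t • wh - q' = (wh' - (rq - m)) + ((rq - q') - (m - t • wh)) := by abel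
    have c1 := norm_add_le (wh' - (rq - m)) ((rq - q') - (m - t • wh))
    have c2 := norm_sub_le (rq - q') (m - t • wh)
    rw [← e] at c1
    have c3 : B * (3 * C + B) * u ^ 2 ≤ M * u ^ 2 := by
      rw [hM]; gcongr ?_ * ?_ * _; nlinarith
    linarith

/-- One step of `x' = x + y w` in floating point arithmetic, where `m` is the computed `y w`. The
number `ζ` is the scale of the iterates. -/
lemma updX_step_error {x x' xh xh' m w wh : E} {y u ζ B C D : ℝ} (hu : 0 ≤ u) (hu1 : u ≤ 1)
    (hζ : 0 ≤ ζ) (hB : 0 ≤ B) (hC : 0 ≤ C) (hD : 0 ≤ D) (hy : |y| ≤ B * ζ) (hw : ‖w‖ ≤ B)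
    (hx' : ‖x'‖ ≤ B * ζ) (hrec : x' = x + y • w)
    (h2 : ‖m - y • wh‖ ≤ (2 * u + u ^ 2) * (|y| * ‖wh‖))
    (h3 : ‖xh' - (xh + m)‖ ≤ u * ‖xh + m‖) (hd : ‖wh - w‖ ≤ C * u) (hx : ‖xh - x‖ ≤ D * u * ζ) :
    ‖xh' - x'‖ ≤ (B + 2 * (D + B * (3 * B + 4 * C))) * u * ζ ∧
      ‖xh' - xh - y • wh‖ ≤ u * (‖x'‖ + 2 * (|y| * ‖w‖)) +
        (D + 2 * (B * (3 * B + 4 * C))) * u ^ 2 * ζ := by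
  obtain ⟨a1, a2⟩ := norm_smul_computed_le hu hu1 (mul_nonneg hB hζ) hC hy hw hd h2
  set M := B * (3 * B + 4 * C) with hM
  have hM0 : 0 ≤ M := by positivity
  have a2' : ‖m - y • w‖ ≤ M * u * ζ := by rw [hM]; linarith
  have b2 : ‖(xh + m) - x'‖ ≤ (D + M) * u * ζ := by
    have e : (xh + m) - x' = (xh - x) + (m - y • w) := by rw [hrec]; abel
    rw [e]
    have := norm_add_le (xh - x) (m - y • w)
    linarith
  have b3 : ‖xh + m‖ ≤ ‖x'‖ + (D + M) * u * ζ := by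
    have := norm_add_le ((xh + m) - x') x'
    rw [sub_add_cancel] at this
    linarith
  have b4 : u * ‖xh + m‖ ≤ u * (‖x'‖ + (D + M) * u * ζ) := mul_le_mul_of_nonneg_left b3 hu
  constructor
  · have e : xh' - x' = (xh' - (xh + m)) + ((xh + m) - x') := by abel
    have := norm_add_le (xh' - (xh + m)) ((xh + m) - x')
    rw [← e] at this
    have c1 : u * ‖x'‖ ≤ u * (B * ζ) := mul_le_mul_of_nonneg_left hx' hu
    have c2 : u * ((D + M) * u * ζ) ≤ (D + M) * u * ζ := by
      have : 0 ≤ (D + M) * u * ζ := by positivity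
      nlinarith
    linarith
  · have e : xh' - xh - y • wh = (xh' - (xh + m)) + (m - y • wh) := by abel
    have c1 := norm_add_le (xh' - (xh + m)) (m - y • wh)
    rw [← e] at c1
    have c3 : B * ζ * (3 * C + B) * u ^ 2 ≤ M * u ^ 2 * ζ := by
      have : B * ζ * (3 * C + B) * u ^ 2 = B * (3 * C + B) * u ^ 2 * ζ := by ring
      rw [this, hM]; gcongr ?_ * ?_ * _ * _; nlinarith
    linarith

end Recurrences

/-- Error of the computed `w_j` and, to first order, the local errors of their recurrence, for
coefficients, `q_j` and exact `w_j` bounded by `B`. -/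
lemma exists_updW_error (B : ℝ) (hB : 0 ≤ B) (k : ℕ) : ∃ C : ℝ, 0 ≤ C ∧
    ∀ {n : ℕ} {u : ℝ} (_ : u ≤ 1) (G : FloatArith u) (q : ℕ → Fin n → ℝ) (ρ θ : ℕ → ℝ),
      (∀ j < k, ρ j ≠ 0) → (∀ j, j + 1 < k → |θ j / ρ j| ≤ B) →
      (∀ j < k, ‖WithLp.toLp 2 (q j)‖ ≤ B) →
      (∀ j < k, ‖WithLp.toLp 2 (updW exactArith q ρ θ j)‖ ≤ B) → ∀ j < k,
      ‖WithLp.toLp 2 (updW G q ρ θ j) - WithLp.toLp 2 (updW exactArith q ρ θ j)‖ ≤ C * u ∧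
      ∀ i, j = i + 1 →
        ‖WithLp.toLp 2 (updW G q ρ θ (i + 1)) + (θ i / ρ i) • WithLp.toLp 2 (updW G q ρ θ i) -
          WithLp.toLp 2 (q (i + 1))‖ ≤
        u * (‖WithLp.toLp 2 (q (i + 1))‖ + ‖WithLp.toLp 2 (updW exactArith q ρ θ (i + 1))‖ +
          2 * (|θ i / ρ i| * ‖WithLp.toLp 2 (updW exactArith q ρ θ i)‖)) + C * u ^ 2 := by
  induction k with
  | zero => exact ⟨0, le_rfl, fun _ _ _ _ _ _ _ _ _ _ h => absurd h (Nat.not_lt_zero _)⟩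
  | succ k ih =>
    obtain ⟨C, hC, ih⟩ := ih
    set C' := B + 2 * (B + B * (3 * B + 4 * C)) + C with hC'
    have hC'0 : 0 ≤ C' := by positivity
    refine ⟨C', hC'0, fun {n u} hu1 G q ρ θ h1 h2 h3 h4 j hj => ?_⟩
    have hu := G.nonneg
    cases j with
    | zero =>
      refine ⟨(norm_rnd_sub_le G (q 0)).trans ?_, fun i hi => absurd hi (by omega)⟩
      have hBC : B ≤ C' := by
        have : 0 ≤ B * (3 * B + 4 * C) := by positivity
        linarith
      rw [mul_comm]
      exact mul_le_mul_of_nonneg_right ((h3 0 hj).trans hBC) hu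
    | succ i =>
      have hd := (ih hu1 G q ρ θ (fun j hj => h1 j (by omega)) (fun j hj => h2 j (by omega))
        (fun j hj => h3 j (by omega)) (fun j hj => h4 j (by omega)) i (by omega)).1
      obtain ⟨s1, s2⟩ := updW_step_error hu hu1 hB hC (h2 i hj) (h3 _ hj) (h4 i (by omega))
        (h4 _ hj) (by rfl) (norm_rnd_sub_le G (q (i + 1)))
        (norm_mul_div_sub_le G (updW G q ρ θ i) (h1 i (by omega)))
        (norm_sub_sub_le G (fun a => G.rnd (q (i + 1) a))
          (fun a => G.mul (G.div (θ i) (ρ i)) (updW G q ρ θ i a))) hd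
      refine ⟨s1.trans ?_, fun i' hi' => ?_⟩
      · gcongr
        linarith
      · obtain rfl : i = i' := by omega
        refine s2.trans ?_
        gcongr
        rw [hC']
        linarith

/-- Error of the computed `x_k` and, to first order, the local errors of the recurrence for the
`x_j`, when the coefficients `φ_j / ρ_j` and the exact `x_j` have size `ζ` and the computed `w_j`
have errors `C u`. -/
lemma exists_updX_error (B : ℝ) (hB : 0 ≤ B) (C : ℝ) (hC : 0 ≤ C) (k : ℕ) : ∃ D : ℝ, 0 ≤ D ∧
    ∀ {n : ℕ} {u ζ : ℝ} (_ : u ≤ 1) (_ : 0 ≤ ζ) (G : FloatArith u) (q : ℕ → Fin n → ℝ)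
      (ρ θ φ : ℕ → ℝ),
      (∀ j < k, ρ j ≠ 0) → (∀ j < k, |φ j / ρ j| ≤ B * ζ) →
      (∀ j < k, ‖WithLp.toLp 2 (updW exactArith q ρ θ j)‖ ≤ B) →
      (∀ j < k, ‖WithLp.toLp 2 (updX exactArith q ρ θ φ (j + 1))‖ ≤ B * ζ) →
      (∀ j < k, ‖WithLp.toLp 2 (updW G q ρ θ j) - WithLp.toLp 2 (updW exactArith q ρ θ j)‖
        ≤ C * u) →
      ‖WithLp.toLp 2 (updX G q ρ θ φ k) - WithLp.toLp 2 (updX exactArith q ρ θ φ k)‖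
        ≤ D * u * ζ ∧
      ∀ j < k,
      ‖WithLp.toLp 2 (updX G q ρ θ φ (j + 1)) - WithLp.toLp 2 (updX G q ρ θ φ j) -
          (φ j / ρ j) • WithLp.toLp 2 (updW G q ρ θ j)‖ ≤
        u * (‖WithLp.toLp 2 (updX exactArith q ρ θ φ (j + 1))‖ +
          2 * (|φ j / ρ j| * ‖WithLp.toLp 2 (updW exactArith q ρ θ j)‖)) + D * u ^ 2 * ζ := by
  induction k with
  | zero =>
    refine ⟨0, le_rfl, fun _ _ _ _ _ _ _ _ _ _ _ _ => ⟨?_, fun j h => ?_⟩⟩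
    · simp [updX]
    · exact absurd h (Nat.not_lt_zero _)
  | succ k ih =>
    obtain ⟨D, hD, ih⟩ := ih
    set D' := B + 2 * (D + B * (3 * B + 4 * C)) with hD'
    have hD'0 : 0 ≤ D' := by positivity
    refine ⟨D', hD'0, fun {n u ζ} hu1 hζ G q ρ θ φ h1 h2 h3 h4 h5 => ?_⟩
    have hu := G.nonneg
    obtain ⟨ih1, ih2⟩ := ih hu1 hζ G q ρ θ φ (fun j hj => h1 j (by omega))
      (fun j hj => h2 j (by omega)) (fun j hj => h3 j (by omega)) (fun j hj => h4 j (by omega))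
      (fun j hj => h5 j (by omega))
    have hk := k.lt_succ_self
    obtain ⟨key1, key2⟩ := updX_step_error hu hu1 hζ hB hC hD (h2 k hk) (h3 k hk) (h4 k hk)
      (by rfl) (norm_mul_div_sub_le G (updW G q ρ θ k) (h1 k hk))
      (norm_add_sub_le G (updX G q ρ θ φ k)
        (fun a => G.mul (G.div (φ k) (ρ k)) (updW G q ρ θ k a))) (h5 k hk) ih1
    refine ⟨key1, fun j hj => ?_⟩
    have hM : 0 ≤ B * (3 * B + 4 * C) := by positivity
    rcases Nat.lt_succ_iff_lt_or_eq.1 hj with h | rfl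
    · refine (ih2 j h).trans ?_
      gcongr
      linarith
    · refine key2.trans ?_
      gcongr
      linarith

/-! ### The spectral norm and bidiagonal matrices -/

lemma norm_toLp_mulVec_le {k : ℕ} (M : Matrix (Fin k) (Fin k) ℝ) (v : Fin k → ℝ) :
    ‖WithLp.toLp 2 (M *ᵥ v)‖ ≤ specNorm M * ‖WithLp.toLp 2 v‖ := by
  have := (Matrix.toEuclideanCLM (𝕜 := ℝ) M).le_opNorm (WithLp.toLp 2 v)
  rwa [Matrix.toEuclideanCLM_toLp] at this

lemma specNorm_nonneg {k : ℕ} (M : Matrix (Fin k) (Fin k) ℝ) : 0 ≤ specNorm M := norm_nonneg _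

lemma specNorm_transpose {k : ℕ} (M : Matrix (Fin k) (Fin k) ℝ) : specNorm Mᵀ = specNorm M := by
  have : Mᵀ = star M := by
    ext i j; simp [Matrix.star_apply]
  rw [specNorm, this, map_star, ContinuousLinearMap.star_eq_adjoint, LinearIsometryEquiv.norm_map,
    specNorm]

lemma norm_toLp_col_le {k : ℕ} (M : Matrix (Fin k) (Fin k) ℝ) (j : Fin k) :
    ‖WithLp.toLp 2 (fun i => M i j)‖ ≤ specNorm M := by
  have h : (fun i => M i j) = M *ᵥ Pi.single j 1 := by ext i; simp
  have := norm_toLp_mulVec_le M (Pi.single j 1)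
  rw [← h] at this
  simpa using this

lemma abs_apply_le_specNorm {k : ℕ} (M : Matrix (Fin k) (Fin k) ℝ) (i j : Fin k) :
    |M i j| ≤ specNorm M := by
  have h := PiLp.norm_apply_le (WithLp.toLp 2 (fun i => M i j)) i
  exact h.trans (norm_toLp_col_le M j)

/-- The unit upper bidiagonal matrix of size `k` with superdiagonal entries `t 0, t 1, …`. -/
def bidiag (t : ℕ → ℝ) (k : ℕ) : Matrix (Fin k) (Fin k) ℝ :=
  Matrix.of fun i j => if i = j then 1 else if (i : ℕ) + 1 = j then t i else 0

lemma det_bidiag (t : ℕ → ℝ) (k : ℕ) : (bidiag t k).det = 1 := by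
  rw [Matrix.det_of_isUpperTriangular]
  · simp [bidiag]
  · intro i j hij
    have hij' : (j : ℕ) < i := hij
    have h1 : i ≠ j := by rintro rfl; omega
    have h2 : (i : ℕ) + 1 ≠ j := by omega
    simp [bidiag, h1, h2]

/-- The relation `W R = Q` for the bidiagonal matrix `R`, column by column: `d` and `e` are the
sequences of columns of `W` and `Q`. -/
lemma sum_bidiag_smul {E : Type*} [AddCommGroup E] [Module ℝ E] (t : ℕ → ℝ) {k : ℕ} (d e : ℕ → E)
    (h0 : d 0 = e 0) (hs : ∀ j, j + 1 < k → d (j + 1) + t j • d j = e (j + 1)) (i : Fin k) :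
    ∑ j : Fin k, bidiag t k j i • d j = e i := by
  obtain ⟨i, hi⟩ := i
  cases i with
  | zero =>
    rw [Finset.sum_eq_single ⟨0, hi⟩]
    · simp [bidiag, h0]
    · intro j _ hj
      simp [bidiag, hj]
    · simp
  | succ i =>
    rw [← hs i hi, Finset.sum_eq_add (⟨i + 1, hi⟩ : Fin k) (⟨i, by omega⟩ : Fin k)]
    · simp [bidiag]
    · simp
    · intro j _ hj
      have h2 : (j : ℕ) ≠ i := fun h => hj.2 (Fin.ext h)
      simp [bidiag, hj.1, h2]
    · simp
    · simp

/-- If `W R = Q` for the bidiagonal matrix `R`, then `∑ (R z)_j w_j = ∑ z_i q_i`. -/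
lemma sum_mulVec_bidiag_smul {E : Type*} [AddCommGroup E] [Module ℝ E] (t : ℕ → ℝ) {k : ℕ}
    (d e : ℕ → E) (h0 : d 0 = e 0) (hs : ∀ j, j + 1 < k → d (j + 1) + t j • d j = e (j + 1))
    (z : Fin k → ℝ) :
    ∑ j : Fin k, (bidiag t k *ᵥ z) j • d j = ∑ i : Fin k, z i • e i := by
  simp_rw [Matrix.mulVec, dotProduct, Finset.sum_smul]
  rw [Finset.sum_comm]
  refine Finset.sum_congr rfl fun i _ => ?_
  rw [← sum_bidiag_smul t d e h0 hs i, Finset.smul_sum]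
  refine Finset.sum_congr rfl fun j _ => ?_
  rw [smul_smul, mul_comm]

lemma one_le_specNorm_bidiag (t : ℕ → ℝ) {k : ℕ} (hk : 0 < k) : 1 ≤ specNorm (bidiag t k) := by
  have := abs_apply_le_specNorm (bidiag t k) ⟨0, hk⟩ ⟨0, hk⟩
  simpa [bidiag] using this

lemma inv_bidiag_mul (t : ℕ → ℝ) (k : ℕ) : (bidiag t k)⁻¹ * bidiag t k = 1 :=
  Matrix.nonsing_inv_mul _ (by rw [det_bidiag]; exact isUnit_one)

lemma bidiag_mul_inv (t : ℕ → ℝ) (k : ℕ) : bidiag t k * (bidiag t k)⁻¹ = 1 :=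
  Matrix.mul_nonsing_inv _ (by rw [det_bidiag]; exact isUnit_one)

lemma one_le_specNorm_inv_bidiag (t : ℕ → ℝ) {k : ℕ} (hk : 0 < k) :
    1 ≤ specNorm (bidiag t k)⁻¹ := by
  -- the first unit vector is fixed by the matrix and hence by its inverse
  have h1 : bidiag t k *ᵥ Pi.single ⟨0, hk⟩ 1 = Pi.single ⟨0, hk⟩ 1 := by
    ext i
    by_cases h : i = ⟨0, hk⟩
    · subst h; simp [bidiag]
    · simp [bidiag, h]
  have h2 : (bidiag t k)⁻¹ *ᵥ Pi.single ⟨0, hk⟩ 1 = Pi.single ⟨0, hk⟩ 1 := by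
    conv_lhs => rw [← h1]
    rw [Matrix.mulVec_mulVec, inv_bidiag_mul, Matrix.one_mulVec]
  have := norm_toLp_mulVec_le (bidiag t k)⁻¹ (Pi.single ⟨0, hk⟩ 1)
  rw [h2] at this
  simpa using this

lemma abs_le_specNorm_bidiag (t : ℕ → ℝ) {k j : ℕ} (hj : j + 1 < k) :
    |t j| ≤ specNorm (bidiag t k) := by
  have := abs_apply_le_specNorm (bidiag t k) ⟨j, by omega⟩ ⟨j + 1, hj⟩
  simpa [bidiag] using this

/-- Cauchy-Schwarz for the column `(t_j, 1)` of the bidiagonal matrix. -/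
lemma abs_mul_add_le_of_bidiag (t : ℕ → ℝ) {k j : ℕ} (hj : j + 1 < k) {a b ω : ℝ}
    (hω : 0 ≤ ω) (h : a ^ 2 + b ^ 2 ≤ ω ^ 2) :
    |t j| * a + b ≤ specNorm (bidiag t k) * ω := by
  have h1 : 1 + t j ^ 2 ≤ specNorm (bidiag t k) ^ 2 := by
    have h2 := norm_toLp_col_le (bidiag t k) ⟨j + 1, hj⟩
    have h3 := pow_le_pow_left₀ (norm_nonneg _) h2 2
    refine le_trans ?_ h3
    rw [EuclideanSpace.real_norm_sq_eq]
    refine le_trans ?_ (Finset.sum_le_sum_of_subset_of_nonneg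
      (Finset.subset_univ {(⟨j + 1, hj⟩ : Fin k), (⟨j, by omega⟩ : Fin k)})
      fun _ _ _ => sq_nonneg _)
    rw [Finset.sum_pair (by simp)]
    simp [bidiag]
  have h0 := specNorm_nonneg (bidiag t k)
  refine abs_le_of_sq_le_sq' ?_ (by positivity) |>.2
  rw [mul_pow]
  have h4 : (1 + t j ^ 2) * (a ^ 2 + b ^ 2) ≤ specNorm (bidiag t k) ^ 2 * ω ^ 2 :=
    mul_le_mul h1 h (by positivity) (by positivity)
  nlinarith [sq_nonneg (|t j| * b - a), sq_abs (t j)]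

/-- If `W R = Q`, then `‖W‖_F ≤ ‖R⁻¹‖ ‖Q‖_F`. -/
lemma sum_norm_sq_le_of_bidiag {n k : ℕ} (t : ℕ → ℝ) (w q : ℕ → EuclideanSpace ℝ (Fin n))
    (h0 : w 0 = q 0) (hs : ∀ j, j + 1 < k → w (j + 1) + t j • w j = q (j + 1)) :
    ∑ j : Fin k, ‖w j‖ ^ 2 ≤ specNorm (bidiag t k)⁻¹ ^ 2 * ∑ j : Fin k, ‖q j‖ ^ 2 := by
  simp_rw [EuclideanSpace.real_norm_sq_eq]
  rw [Finset.sum_comm, Finset.sum_comm (s := Finset.univ (α := Fin k)), Finset.mul_sum]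
  refine Finset.sum_le_sum fun a _ => ?_
  have h1 : (bidiag t k)ᵀ *ᵥ (fun j : Fin k => w j a) = fun j : Fin k => q j a := by
    ext i
    have := congrArg (fun v : EuclideanSpace ℝ (Fin n) => v a) (sum_bidiag_smul t w q h0 hs i)
    simpa [Matrix.mulVec, dotProduct] using this
  have h2 : (bidiag t k)⁻¹ᵀ *ᵥ (fun j : Fin k => q j a) = fun j : Fin k => w j a := by
    rw [← h1, Matrix.mulVec_mulVec, ← Matrix.transpose_mul, bidiag_mul_inv,
      Matrix.transpose_one, Matrix.one_mulVec]
  have h3 := norm_toLp_mulVec_le (bidiag t k)⁻¹ᵀ (fun j : Fin k => q j a)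
  rw [h2, specNorm_transpose] at h3
  have h4 := pow_le_pow_left₀ (norm_nonneg _) h3 2
  rwa [mul_pow, EuclideanSpace.real_norm_sq_eq, EuclideanSpace.real_norm_sq_eq] at h4

lemma sum_mul_le_norm_mul {k : ℕ} (z : Fin k → ℝ) (a : Fin k → ℝ) {ω : ℝ} (hω : 0 ≤ ω)
    (h : ∑ i, a i ^ 2 ≤ ω ^ 2) : ∑ i, |z i| * a i ≤ ‖WithLp.toLp 2 z‖ * ω := by
  refine abs_le_of_sq_le_sq' ?_ (by positivity) |>.2
  refine (Finset.sum_mul_sq_le_sq_mul_sq _ _ _).trans ?_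
  rw [mul_pow, EuclideanSpace.real_norm_sq_eq]
  simp_rw [sq_abs]
  gcongr

lemma sum_abs_le_sqrt_mul_norm {k : ℕ} (z : Fin k → ℝ) :
    ∑ i, |z i| ≤ √k * ‖WithLp.toLp 2 z‖ := by
  have := sum_mul_le_norm_mul z (fun _ => 1) (Real.sqrt_nonneg k) (by simp)
  simpa [mul_comm] using this

/-- A matrix with nearly orthonormal columns is nearly isometric. -/
lemma norm_le_of_near_orthonormal {n k : ℕ} (q : ℕ → EuclideanSpace ℝ (Fin n)) {δ : ℝ}
    (hδ : 0 ≤ δ) (hkδ : k * δ ≤ 1)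
    (h : ∀ i j : Fin k, |inner ℝ (q i) (q j) - if i = j then 1 else 0| ≤ δ) (z : Fin k → ℝ) :
    (1 - k * δ) * ‖WithLp.toLp 2 z‖ ≤ ‖∑ i : Fin k, z i • q i‖ := by
  have h1 : ‖∑ i : Fin k, z i • q i‖ ^ 2 - ‖WithLp.toLp 2 z‖ ^ 2 =
      ∑ i : Fin k, ∑ j : Fin k, z i * z j * (inner ℝ (q i) (q j) - if i = j then 1 else 0) := by
    rw [← real_inner_self_eq_norm_sq, sum_inner, EuclideanSpace.real_norm_sq_eq,
      ← Finset.sum_sub_distrib]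
    refine Finset.sum_congr rfl fun i _ => ?_
    rw [inner_sum]
    simp_rw [mul_sub, Finset.sum_sub_distrib]
    simp [inner_smul_left, inner_smul_right, mul_assoc, mul_left_comm, pow_two]
  have h2 : |‖∑ i : Fin k, z i • q i‖ ^ 2 - ‖WithLp.toLp 2 z‖ ^ 2| ≤
      k * δ * ‖WithLp.toLp 2 z‖ ^ 2 := by
    rw [h1]
    calc _ ≤ ∑ i : Fin k, ∑ j : Fin k, |z i| * |z j| * δ := by
          refine (Finset.abs_sum_le_sum_abs _ _).trans (Finset.sum_le_sum fun i _ => ?_)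
          refine (Finset.abs_sum_le_sum_abs _ _).trans (Finset.sum_le_sum fun j _ => ?_)
          rw [abs_mul, abs_mul]
          exact mul_le_mul_of_nonneg_left (h i j) (by positivity)
      _ = (∑ i, |z i|) ^ 2 * δ := by
          rw [pow_two, Finset.sum_mul_sum, Finset.sum_mul]
          simp_rw [Finset.sum_mul]
      _ ≤ (√k * ‖WithLp.toLp 2 z‖) ^ 2 * δ := by
          gcongr
          exact sum_abs_le_sqrt_mul_norm z
      _ = k * δ * ‖WithLp.toLp 2 z‖ ^ 2 := by
          rw [mul_pow, Real.sq_sqrt (Nat.cast_nonneg k)]; ring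
  have h3 := (abs_le.1 h2).1
  refine abs_le_of_sq_le_sq' ?_ (norm_nonneg _) |>.2
  have h4 : 0 ≤ k * δ := by positivity
  have h5 : (1 - k * δ) ^ 2 ≤ 1 - k * δ := by nlinarith
  rw [mul_pow]
  nlinarith [mul_le_mul_of_nonneg_right h5 (sq_nonneg ‖WithLp.toLp 2 z‖)]

/-! ### The error of the computed iterate for given nearly orthonormal vectors -/

lemma toLp_updW_exact_succ {n : ℕ} (q : ℕ → Fin n → ℝ) (ρ θ : ℕ → ℝ) (j : ℕ) :
    WithLp.toLp 2 (updW exactArith q ρ θ (j + 1)) + (θ j / ρ j) •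
      WithLp.toLp 2 (updW exactArith q ρ θ j) = WithLp.toLp 2 (q (j + 1)) := by
  ext a
  simp [updW, exactArith]

lemma toLp_updX_exact {n : ℕ} (q : ℕ → Fin n → ℝ) (ρ θ φ : ℕ → ℝ) (l : ℕ) :
    WithLp.toLp 2 (updX exactArith q ρ θ φ l) = ∑ j ∈ Finset.range l,
      (φ j / ρ j) • WithLp.toLp 2 (updW exactArith q ρ θ j) := by
  induction l with
  | zero => rfl
  | succ l ih => rw [Finset.sum_range_succ, ← ih]; rfl

section Propagation

variable {n k : ℕ} {t y : ℕ → ℝ} {q W Wh X Xh : ℕ → EuclideanSpace ℝ (Fin n)} {z : Fin k → ℝ}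

lemma norm_le_of_sum_sq_le {ω : ℝ} (hω : 0 ≤ ω) (hWF : ∑ j : Fin k, ‖W j‖ ^ 2 ≤ ω ^ 2) {j : ℕ}
    (hj : j < k) : ‖W j‖ ≤ ω := by
  have h := Finset.single_le_sum (f := fun j : Fin k => ‖W j‖ ^ 2) (fun _ _ => sq_nonneg _)
    (Finset.mem_univ (⟨j, hj⟩ : Fin k))
  exact (abs_le_of_sq_le_sq' (h.trans hWF) hω).2

lemma sum_abs_mul_norm_le (hz : bidiag t k *ᵥ z = fun j : Fin k => y j) {ω : ℝ} (hω : 0 ≤ ω)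
    (hWF : ∑ j : Fin k, ‖W j‖ ^ 2 ≤ ω ^ 2) :
    ∑ j ∈ Finset.range k, |y j| * ‖W j‖ ≤ specNorm (bidiag t k) * ‖WithLp.toLp 2 z‖ * ω := by
  rw [← Fin.sum_univ_eq_sum_range (fun j => |y j| * ‖W j‖)]
  refine (sum_mul_le_norm_mul (fun j : Fin k => y j) (fun j => ‖W j‖) hω hWF).trans ?_
  refine mul_le_mul_of_nonneg_right ?_ hω
  rw [← hz]
  exact norm_toLp_mulVec_le _ _

/-- The `l`-th iterate is at most `‖R‖ ‖z‖ ω`, where `ω` bounds the Frobenius norm of `W`. -/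
lemma norm_sum_range_smul_le (hz : bidiag t k *ᵥ z = fun j : Fin k => y j) {ω : ℝ} (hω : 0 ≤ ω)
    (hWF : ∑ j : Fin k, ‖W j‖ ^ 2 ≤ ω ^ 2) {l : ℕ} (hl : l ≤ k) :
    ‖∑ j ∈ Finset.range l, y j • W j‖ ≤ specNorm (bidiag t k) * ‖WithLp.toLp 2 z‖ * ω := by
  refine (norm_sum_le _ _).trans (le_trans ?_ (sum_abs_mul_norm_le hz hω hWF))
  simp_rw [norm_smul, Real.norm_eq_abs]
  exact Finset.sum_le_sum_of_subset_of_nonneg (Finset.range_mono hl) fun _ _ _ => by positivity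

/-- The contribution of the errors of the `w_j` to the iterate: it is `∑ z_j e_j`, where the `e_j`
are the local errors of the recurrence for the `w_j`. -/
lemma norm_sum_smul_sub_le (hW0 : W 0 = q 0)
    (hWrec : ∀ j, j + 1 < k → W (j + 1) + t j • W j = q (j + 1))
    (hz : bidiag t k *ᵥ z = fun j : Fin k => y j) {ω η u C : ℝ} (hω : 0 ≤ ω) (hη : 0 ≤ η)
    (hu : 0 ≤ u) (hC : 0 ≤ C) (hq : ∀ j < k, ‖q j‖ ≤ η) (hWF : ∑ j : Fin k, ‖W j‖ ^ 2 ≤ ω ^ 2)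
    (h0 : ‖Wh 0 - q 0‖ ≤ u * ‖q 0‖)
    (hrec : ∀ i, i + 1 < k → ‖Wh (i + 1) + t i • Wh i - q (i + 1)‖ ≤
      u * (‖q (i + 1)‖ + ‖W (i + 1)‖ + 2 * (|t i| * ‖W i‖)) + C * u ^ 2) :
    ‖∑ j : Fin k, y j • (Wh j - W j)‖ ≤ √k * ‖WithLp.toLp 2 z‖ *
      (u * (η + 2 * (specNorm (bidiag t k) * ω)) + C * u ^ 2) := by
  set r := specNorm (bidiag t k) with hr
  have hr0 : 0 ≤ r := specNorm_nonneg _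
  let e : ℕ → EuclideanSpace ℝ (Fin n) := fun j =>
    Nat.casesOn j (Wh 0 - W 0) fun i => (Wh (i + 1) - W (i + 1)) + t i • (Wh i - W i)
  have hsum := sum_mulVec_bidiag_smul t (fun j => Wh j - W j) e rfl (fun _ _ => rfl) z
  rw [hz] at hsum
  have he : ∀ j < k, ‖e j‖ ≤ u * (η + 2 * (r * ω)) + C * u ^ 2 := by
    intro j hj
    cases j with
    | zero =>
      change ‖Wh 0 - W 0‖ ≤ _
      rw [hW0]
      have h2 : u * ‖q 0‖ ≤ u * η := mul_le_mul_of_nonneg_left (hq 0 hj) hu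
      have h3 : 0 ≤ u * (2 * (r * ω)) + C * u ^ 2 := by positivity
      linarith
    | succ i =>
      have h2 : e (i + 1) = Wh (i + 1) + t i • Wh i - q (i + 1) := by
        change (Wh (i + 1) - W (i + 1)) + t i • (Wh i - W i) = _
        rw [← hWrec i hj, smul_sub]
        abel
      have h3 : |t i| * ‖W i‖ + ‖W (i + 1)‖ ≤ r * ω := by
        refine abs_mul_add_le_of_bidiag t hj hω (le_trans ?_ hWF)
        have h := Finset.sum_le_sum_of_subset_of_nonneg (f := fun j : Fin k => ‖W j‖ ^ 2)
          (Finset.subset_univ {(⟨i, by omega⟩ : Fin k), (⟨i + 1, hj⟩ : Fin k)})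
          fun _ _ _ => sq_nonneg _
        rwa [Finset.sum_pair (by simp)] at h
      rw [h2]
      refine (hrec i hj).trans ?_
      have h4 := hq _ hj
      have h5 := norm_nonneg (W (i + 1))
      have h6 : ‖q (i + 1)‖ + ‖W (i + 1)‖ + 2 * (|t i| * ‖W i‖) ≤ η + 2 * (r * ω) := by linarith
      have := mul_le_mul_of_nonneg_left h6 hu
      linarith
  rw [hsum]
  refine (norm_sum_le _ _).trans ?_
  simp_rw [norm_smul, Real.norm_eq_abs]
  calc _ ≤ ∑ i : Fin k, |z i| * (u * (η + 2 * (r * ω)) + C * u ^ 2) :=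
        Finset.sum_le_sum fun i _ => mul_le_mul_of_nonneg_left (he i i.2) (abs_nonneg _)
    _ ≤ _ := by
        rw [← Finset.sum_mul]
        exact mul_le_mul_of_nonneg_right (sum_abs_le_sqrt_mul_norm z) (by positivity)

/-- The accumulated local errors of the recurrence for the `x_j`. -/
lemma norm_sum_local_errors_le (hX : ∀ l, X l = ∑ j ∈ Finset.range l, y j • W j)
    (hz : bidiag t k *ᵥ z = fun j : Fin k => y j) {ω u D : ℝ} (hω : 0 ≤ ω) (hu : 0 ≤ u)
    (hWF : ∑ j : Fin k, ‖W j‖ ^ 2 ≤ ω ^ 2)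
    (hrec : ∀ j < k, ‖Xh (j + 1) - Xh j - y j • Wh j‖ ≤
      u * (‖X (j + 1)‖ + 2 * (|y j| * ‖W j‖)) + D * u ^ 2 * ‖WithLp.toLp 2 z‖) :
    ‖∑ j ∈ Finset.range k, (Xh (j + 1) - Xh j - y j • Wh j)‖ ≤
      u * ((k + 2) * (specNorm (bidiag t k) * ‖WithLp.toLp 2 z‖ * ω)) +
        k * D * u ^ 2 * ‖WithLp.toLp 2 z‖ := by
  set S := specNorm (bidiag t k) * ‖WithLp.toLp 2 z‖ * ω with hS
  refine (norm_sum_le _ _).trans ?_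
  calc _ ≤ ∑ j ∈ Finset.range k, (u * S +
          2 * u * (|y j| * ‖W j‖) + D * u ^ 2 * ‖WithLp.toLp 2 z‖) := by
        refine Finset.sum_le_sum fun j hj => ?_
        have hj := Finset.mem_range.1 hj
        have h1 := hrec j hj
        have h3 := norm_sum_range_smul_le hz hω hWF (Nat.succ_le_of_lt hj)
        rw [← hX, ← hS] at h3
        have h2 := mul_le_mul_of_nonneg_left h3 hu
        simp only [Nat.succ_eq_add_one] at h2
        linarith
    _ = k * (u * S) + 2 * u * ∑ j ∈ Finset.range k, |y j| * ‖W j‖ +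
          k * (D * u ^ 2 * ‖WithLp.toLp 2 z‖) := by
        rw [Finset.sum_add_distrib, Finset.sum_add_distrib, Finset.mul_sum]
        simp
    _ ≤ _ := by
        have := mul_le_mul_of_nonneg_left (sum_abs_mul_norm_le hz hω hWF)
          (by positivity : 0 ≤ 2 * u)
        rw [← hS] at this
        linarith

/-- The error of the iterate is the sum of the local errors of its recurrence and of the
contribution of the errors of the `w_j`. -/
lemma sub_eq_sum_local_errors (hX : ∀ l, X l = ∑ j ∈ Finset.range l, y j • W j)
    (hXh : Xh 0 = 0) (k : ℕ) :
    Xh k - X k = ∑ j ∈ Finset.range k, (Xh (j + 1) - Xh j - y j • Wh j) +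
      ∑ j : Fin k, y j • (Wh j - W j) := by
  rw [Fin.sum_univ_eq_sum_range (fun j => y j • (Wh j - W j)), Finset.sum_sub_distrib,
    Finset.sum_range_sub]
  simp_rw [smul_sub]
  rw [Finset.sum_sub_distrib, ← hX, hXh]
  abel

end Propagation

/-- First-order error bound for the update recurrences. Here `η` bounds the norms of the `q_j`
and `z = R⁻¹ y` with `y_j = φ_j / ρ_j`. The constants depend only on `k` and `K`. -/
lemma exists_norm_updX_sub_le (k : ℕ) (hk : 0 < k) (K : ℝ) : ∃ C : ℝ, 0 ≤ C ∧
    ∀ {n : ℕ} {ubar η : ℝ} (_ : ubar ≤ 1) (_ : 0 ≤ η) (_ : η ≤ 2) (G : FloatArith ubar)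
      (q : ℕ → Fin n → ℝ) (ρ θ φ : ℕ → ℝ), (∀ j < k, ρ j ≠ 0) →
      (∀ j < k, ‖WithLp.toLp 2 (q j)‖ ≤ η) → cond (bidiag (fun j => θ j / ρ j) k) ≤ K →
      ∀ z : Fin k → ℝ, (bidiag (fun j => θ j / ρ j) k *ᵥ z = fun j : Fin k => φ j / ρ j) →
      ‖WithLp.toLp 2 (updX G q ρ θ φ k) - WithLp.toLp 2 (updX exactArith q ρ θ φ k)‖ ≤
        (√k * (1 + (2 + 2 * √k + k) * cond (bidiag (fun j => θ j / ρ j) k)) * η * ubar +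
          C * ubar ^ 2) * ‖WithLp.toLp 2 z‖ := by
  have hs1 : 1 ≤ √(k : ℝ) := Real.one_le_sqrt.2 (by exact_mod_cast hk)
  -- large enough to bound the `q_j`, the `w_j`, the coefficients, and the iterates divided by `‖z‖`
  obtain ⟨B, hB⟩ : ∃ B, B = 2 * (|K| + 1) ^ 2 * √(k : ℝ) := ⟨_, rfl⟩
  have hB0 : 0 ≤ B := by rw [hB]; positivity
  obtain ⟨C, hC, hW⟩ := exists_updW_error B hB0 k
  obtain ⟨D, hD, hX⟩ := exists_updX_error B hB0 C hC k
  refine ⟨√k * C + k * D, by positivity, ?_⟩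
  intro n ubar η hu1 hη hη2 G q ρ θ φ hρ hq hK z hz
  have hu := G.nonneg
  obtain ⟨r, hr⟩ : ∃ r, r = specNorm (bidiag (fun j => θ j / ρ j) k) := ⟨_, rfl⟩
  obtain ⟨r', hr'⟩ : ∃ r', r' = specNorm (bidiag (fun j => θ j / ρ j) k)⁻¹ := ⟨_, rfl⟩
  have hκ : cond (bidiag (fun j => θ j / ρ j) k) = r * r' := by rw [hr, hr']; rfl
  rw [hκ] at hK ⊢
  have hr1 : 1 ≤ r := hr ▸ one_le_specNorm_bidiag _ hk
  have hr1' : 1 ≤ r' := hr' ▸ one_le_specNorm_inv_bidiag _ hk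
  have hr0 : 0 ≤ r := by linarith
  have hr0' : 0 ≤ r' := by linarith
  have hK1 : 1 ≤ K := le_trans (by nlinarith) hK
  have hrK : r ≤ K := le_trans (by nlinarith) hK
  rw [abs_of_nonneg (by linarith : (0 : ℝ) ≤ K)] at hB
  have h2B : 2 * (K + 1) ^ 2 ≤ B := by
    rw [hB]; exact le_mul_of_one_le_right (by positivity) hs1
  have hrB : r ≤ B := by nlinarith
  obtain ⟨ω, hω⟩ : ∃ ω, ω = r' * (√k * η) := ⟨_, rfl⟩
  have hω0 : 0 ≤ ω := by rw [hω]; positivity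
  have hrωB : r * ω ≤ B := by
    have h1 : r * ω = r * r' * (√k * η) := by rw [hω]; ring
    have h2 : r * r' * (√k * η) ≤ K * (√k * 2) := by gcongr
    rw [h1]
    refine h2.trans ?_
    have h3 : K ≤ (K + 1) ^ 2 := by nlinarith
    have h4 := mul_le_mul_of_nonneg_right h3 (Real.sqrt_nonneg (k : ℝ))
    rw [hB]
    linarith
  have hωB : ω ≤ B := le_trans (by nlinarith) hrωB
  obtain ⟨ζ, hζ⟩ : ∃ ζ, ζ = ‖WithLp.toLp 2 z‖ := ⟨_, rfl⟩
  have hζ0 : 0 ≤ ζ := hζ ▸ norm_nonneg _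
  -- the Frobenius norm of `W = Q R⁻¹` is at most `ω`
  have hWF : ∑ j : Fin k, ‖WithLp.toLp 2 (updW exactArith q ρ θ j)‖ ^ 2 ≤ ω ^ 2 := by
    refine (sum_norm_sq_le_of_bidiag (fun j => θ j / ρ j)
      (fun j => WithLp.toLp 2 (updW exactArith q ρ θ j)) (fun j => WithLp.toLp 2 (q j)) rfl
      fun j _ => toLp_updW_exact_succ q ρ θ j).trans ?_
    have h1 : ∑ j : Fin k, ‖WithLp.toLp 2 (q j)‖ ^ 2 ≤ ∑ _j : Fin k, η ^ 2 :=
      Finset.sum_le_sum fun j _ => pow_le_pow_left₀ (norm_nonneg _) (hq j j.2) 2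
    have h2 : ∑ _j : Fin k, η ^ 2 = (√k * η) ^ 2 := by
      rw [mul_pow, Real.sq_sqrt (Nat.cast_nonneg k)]; simp
    rw [hω, mul_pow, ← h2, ← hr']
    exact mul_le_mul_of_nonneg_left h1 (sq_nonneg _)
  have hWB : ∀ j < k, ‖WithLp.toLp 2 (updW exactArith q ρ θ j)‖ ≤ B := fun j hj => by
    exact (norm_le_of_sum_sq_le (W := fun j => WithLp.toLp 2 (updW exactArith q ρ θ j))
      hω0 hWF hj).trans hωB
  have hqB : ∀ j < k, ‖WithLp.toLp 2 (q j)‖ ≤ B := fun j hj =>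
    ((hq j hj).trans hη2).trans (by nlinarith)
  have htB : ∀ j, j + 1 < k → |θ j / ρ j| ≤ B := fun j hj =>
    ((abs_le_specNorm_bidiag (fun j => θ j / ρ j) hj).trans hr.ge).trans hrB
  have hyB : ∀ j < k, |φ j / ρ j| ≤ B * ζ := fun j hj => by
    have h := PiLp.norm_apply_le (WithLp.toLp 2 (fun j : Fin k => φ j / ρ j)) ⟨j, hj⟩
    have hy := norm_toLp_mulVec_le (bidiag (fun j => θ j / ρ j) k) z
    rw [hz, ← hr, ← hζ] at hy
    exact (h.trans hy).trans (mul_le_mul_of_nonneg_right hrB hζ0)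
  have hXsum := toLp_updX_exact q ρ θ φ
  have hXB : ∀ j < k, ‖WithLp.toLp 2 (updX exactArith q ρ θ φ (j + 1))‖ ≤ B * ζ := fun j hj => by
    rw [hXsum]
    refine (norm_sum_range_smul_le (y := fun j => φ j / ρ j)
      (W := fun j => WithLp.toLp 2 (updW exactArith q ρ θ j)) hz hω0 hWF hj).trans ?_
    rw [← hr, ← hζ, mul_right_comm]
    exact mul_le_mul_of_nonneg_right hrωB hζ0
  have hW' := hW hu1 G q ρ θ hρ htB hqB hWB
  have hX' := (hX hu1 hζ0 G q ρ θ φ hρ hyB hWB hXB fun j hj => (hW' j hj).1).2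
  have hE1 := norm_sum_smul_sub_le (t := fun j => θ j / ρ j) (y := fun j => φ j / ρ j)
    (q := fun j => WithLp.toLp 2 (q j)) (W := fun j => WithLp.toLp 2 (updW exactArith q ρ θ j))
    (Wh := fun j => WithLp.toLp 2 (updW G q ρ θ j)) rfl
    (fun j _ => toLp_updW_exact_succ q ρ θ j) hz hω0 hη hu hC hq hWF (norm_rnd_sub_le G (q 0))
    (fun i hi => (hW' (i + 1) hi).2 i rfl)
  have hE2 := norm_sum_local_errors_le (t := fun j => θ j / ρ j) (y := fun j => φ j / ρ j)
    (W := fun j => WithLp.toLp 2 (updW exactArith q ρ θ j))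
    (Wh := fun j => WithLp.toLp 2 (updW G q ρ θ j))
    (X := fun j => WithLp.toLp 2 (updX exactArith q ρ θ φ j))
    (Xh := fun j => WithLp.toLp 2 (updX G q ρ θ φ j)) (D := D) hXsum hz hω0 hu hWF
    (hζ ▸ hX')
  have hsplit := sub_eq_sum_local_errors (y := fun j => φ j / ρ j)
    (W := fun j => WithLp.toLp 2 (updW exactArith q ρ θ j))
    (Wh := fun j => WithLp.toLp 2 (updW G q ρ θ j))
    (X := fun j => WithLp.toLp 2 (updX exactArith q ρ θ φ j))
    (Xh := fun j => WithLp.toLp 2 (updX G q ρ θ φ j)) hXsum rfl k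
  rw [← hr, ← hζ] at hE1 hE2
  rw [hsplit, ← hζ]
  refine (norm_add_le _ _).trans ((add_le_add hE2 hE1).trans (le_of_eq ?_))
  rw [hω]
  ring

/-- The error bound for nearly orthonormal `q_j`; the constants depend only on `k`, on the
constant `c` of near orthonormality and on the bound `K` of the condition number. -/
lemma exists_updateErrorBound (k : ℕ) (hk : 0 < k) (c K : ℝ) (hc : 0 ≤ c) :
    ∃ C : ℝ, 0 < C ∧ ∃ ε : ℝ, 0 < ε ∧
    ∀ {n : ℕ} {u ubar : ℝ} (_ : 0 ≤ u) (_ : u ≤ ε) (_ : ubar ≤ ε) (G : FloatArith ubar)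
      (q : ℕ → Fin n → ℝ) (ρ θ φ : ℕ → ℝ), (∀ j < k, ρ j ≠ 0) → φ 0 ≠ 0 →
      (∀ i < k, ∀ j < k, |q i ⬝ᵥ q j - if i = j then 1 else 0| ≤ c * u) →
      cond (bidiag (fun j => θ j / ρ j) k) ≤ K →
      UpdateErrorBound (WithLp.toLp 2 (updX G q ρ θ φ k))
        (WithLp.toLp 2 (updX exactArith q ρ θ φ k)) k (cond (bidiag (fun j => θ j / ρ j) k))
        u ubar C := by
  obtain ⟨E, hE, h⟩ := exists_norm_updX_sub_le k hk K
  have hk1 : (1 : ℝ) ≤ k := by exact_mod_cast hk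
  set s := √(k : ℝ) with hs
  have hs0 : 0 ≤ s := Real.sqrt_nonneg _
  set P := s * (1 + (2 + 2 * s + k) * |K|) with hP
  have hP0 : 0 ≤ P := by positivity
  -- the bound on `u` makes `a = k c u ≤ 1 / 2`; the norms of the `q_j` and the quotient
  -- `‖z‖ / ‖x‖` contribute the factors `1 + a` and `1 + 2 a ≥ 1 / (1 - a)`
  refine ⟨4 * (k * c) * P + 2 * E + 1, by positivity, min 1 (1 / (2 * (k * c + 1))),
    by positivity, ?_⟩
  intro n u ubar hu huε hubarε G q ρ θ φ hρ hφ hq hK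
  have hubar := G.nonneg
  have hu2 : k * c * u ≤ 1 / 2 := by
    have h1 : u ≤ 1 / (2 * (k * c + 1)) := huε.trans (min_le_right _ _)
    rw [le_div_iff₀ (by positivity)] at h1
    nlinarith
  have hcu : 0 ≤ c * u := by positivity
  have hcuk : c * u ≤ k * c * u := by nlinarith
  have hqn : ∀ j < k, ‖WithLp.toLp 2 (q j)‖ ≤ 1 + c * u := fun j hj => by
    have h1 := (abs_le.1 (hq j hj j hj)).2
    rw [if_pos rfl] at h1
    refine abs_le_of_sq_le_sq' ?_ (by positivity) |>.2
    rw [EuclideanSpace.real_norm_sq_eq]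
    simp only [dotProduct, ← pow_two] at h1
    nlinarith
  set R := bidiag (fun j => θ j / ρ j) k with hR
  set κ := cond R with hκ
  have hκ0 : 0 ≤ κ := mul_nonneg (specNorm_nonneg _) (specNorm_nonneg _)
  set y : Fin k → ℝ := fun j => φ j / ρ j with hy
  set z : Fin k → ℝ := R⁻¹ *ᵥ y with hz
  have hRz : R *ᵥ z = y := by rw [hz, Matrix.mulVec_mulVec, bidiag_mul_inv, Matrix.one_mulVec]
  -- `x ≠ 0`, because already the first component of `y` does not vanish
  have hy0 : y ≠ 0 := fun h0 => by
    have := congrFun h0 ⟨0, hk⟩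
    exact div_ne_zero hφ (hρ 0 hk) this
  have hz0 : z ≠ 0 := by
    intro h0
    rw [h0, Matrix.mulVec_zero] at hRz
    exact hy0 hRz.symm
  set ζ := ‖WithLp.toLp 2 z‖ with hζ
  have hζ0 : 0 < ζ := norm_pos_iff.2 fun h0 => hz0 (by simpa using congrArg WithLp.ofLp h0)
  have herr := h (hubarε.trans (min_le_left _ _)) (by positivity : 0 ≤ 1 + c * u) (by linarith)
    G q ρ θ φ hρ hqn hK z hRz
  set x := WithLp.toLp 2 (updX exactArith q ρ θ φ k) with hx
  have hxz : x = ∑ i : Fin k, z i • WithLp.toLp 2 (q i) := by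
    rw [hx, toLp_updX_exact, ← sum_mulVec_bidiag_smul (fun j => θ j / ρ j)
      (fun j => WithLp.toLp 2 (updW exactArith q ρ θ j)) (fun j => WithLp.toLp 2 (q j)) rfl
      (fun j _ => toLp_updW_exact_succ q ρ θ j) z, hRz,
      ← Fin.sum_univ_eq_sum_range
        (fun j => (φ j / ρ j) • WithLp.toLp 2 (updW exactArith q ρ θ j))]
  have hlow : (1 - k * (c * u)) * ζ ≤ ‖x‖ := by
    rw [hxz]
    refine norm_le_of_near_orthonormal (fun j => WithLp.toLp 2 (q j)) hcu (by linarith) ?_ z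
    intro i j
    have := hq j j.2 i i.2
    simp only [EuclideanSpace.inner_toLp_toLp, star_trivial]
    simpa [Fin.ext_iff, eq_comm] using this
  have hxpos : 0 < ‖x‖ := lt_of_lt_of_le (mul_pos (by linarith) hζ0) hlow
  refine ⟨norm_pos_iff.1 hxpos, ?_⟩
  rw [div_le_iff₀ hxpos]
  refine herr.trans ?_
  set a := k * c * u with ha
  have ha0 : 0 ≤ a := by positivity
  have hζx : ζ ≤ (1 + 2 * a) * ‖x‖ := by
    have h1 : (1 + 2 * a) * ((1 - k * (c * u)) * ζ) ≤ (1 + 2 * a) * ‖x‖ := by gcongr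
    have h2 : 1 ≤ (1 + 2 * a) * (1 - k * (c * u)) := by
      have h3 : k * (c * u) = a := by rw [ha]; ring
      rw [h3]; nlinarith
    nlinarith
  set Pκ := s * (1 + (2 + 2 * s + k) * κ) with hPκ
  have hPκ0 : 0 ≤ Pκ := by positivity
  have hPκP : Pκ ≤ P := by
    rw [hPκ, hP]
    gcongr
    exact hK.trans (le_abs_self K)
  calc (Pκ * (1 + c * u) * ubar + E * ubar ^ 2) * ζ
      ≤ (Pκ * (1 + a) * ubar + E * ubar ^ 2) * ((1 + 2 * a) * ‖x‖) := by gcongr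
    _ = (Pκ * ubar * ((1 + a) * (1 + 2 * a)) + E * ubar ^ 2 * (1 + 2 * a)) * ‖x‖ := by ring
    _ ≤ (Pκ * ubar * (1 + 4 * a) + E * ubar ^ 2 * 2) * ‖x‖ := by
        gcongr
        · nlinarith
        · linarith
    _ ≤ (Pκ * ubar + (4 * (k * c) * P + 2 * E + 1) * (ubar ^ 2 + ubar * u)) * ‖x‖ := by
        refine mul_le_mul_of_nonneg_right ?_ hxpos.le
        have h1 : Pκ * ubar * a ≤ P * ubar * a := by gcongr
        have h2 : 0 ≤ 4 * (k * c) * P * ubar ^ 2 := by positivity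
        have h3 : 0 ≤ (2 * E) * (ubar * u) := by positivity
        have h4 : 0 ≤ ubar ^ 2 + ubar * u := by positivity
        have h5 : P * ubar * a = k * c * P * (ubar * u) := by rw [ha]; ring
        linarith

/-! ### Normalization in floating point arithmetic and uniform bounds -/

lemma flDot_succ {u : ℝ} (F : FloatArith u) {d : ℕ} (x y : Fin (d + 1) → ℝ) :
    flDot F x y = F.add (flDot F (fun i => x i.castSucc) (fun i => y i.castSucc))
      (F.mul (x (Fin.last d)) (y (Fin.last d))) := by
  simp [flDot, Fin.foldl_succ_last]

lemma flDot_self_mem {u : ℝ} (F : FloatArith u) (hu1 : u ≤ 1) {d : ℕ} (x : Fin d → ℝ) :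
    (1 - u) ^ (d + 1) * (x ⬝ᵥ x) ≤ flDot F x x ∧
      flDot F x x ≤ (1 + u) ^ (d + 1) * (x ⬝ᵥ x) := by
  have hu := F.nonneg
  induction d with
  | zero => simp [flDot]
  | succ d ih =>
    obtain ⟨h1, h2⟩ := ih (fun i => x i.castSucc)
    rw [flDot_succ]
    have hS : x ⬝ᵥ x = (fun i : Fin d => x i.castSucc) ⬝ᵥ (fun i : Fin d => x i.castSucc) +
        x (Fin.last d) * x (Fin.last d) := by
      simp [dotProduct, Fin.sum_univ_castSucc]
    have hS0 : 0 ≤ (fun i : Fin d => x i.castSucc) ⬝ᵥ (fun i : Fin d => x i.castSucc) :=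
      Finset.sum_nonneg fun i _ => mul_self_nonneg _
    rw [hS]
    set S := (fun i : Fin d => x i.castSucc) ⬝ᵥ (fun i : Fin d => x i.castSucc)
    set s := flDot F (fun i : Fin d => x i.castSucc) (fun i : Fin d => x i.castSucc)
    set y := x (Fin.last d)
    have hy : 0 ≤ y * y := mul_self_nonneg y
    have hm := abs_le.1 (F.mul_err y y)
    rw [abs_of_nonneg hy] at hm
    have hl : 0 ≤ 1 - u := by linarith
    have m1 : (1 - u) ^ (d + 1) * (y * y) ≤ F.mul y y := by
      have := mul_le_mul_of_nonneg_right (pow_le_of_le_one hl (by linarith) (n := d + 1)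
        (by omega)) hy
      linarith
    have m2 : F.mul y y ≤ (1 + u) ^ (d + 1) * (y * y) := by
      have := mul_le_mul_of_nonneg_right (le_self_pow₀ (by linarith : 1 ≤ 1 + u) (n := d + 1)
        (by omega)) hy
      linarith
    have h0 : 0 ≤ s + F.mul y y := by
      have : 0 ≤ (1 - u) ^ (d + 1) * S := by positivity
      have : 0 ≤ (1 - u) ^ (d + 1) * (y * y) := by positivity
      linarith
    have ha := abs_le.1 (F.add_err s (F.mul y y))
    rw [abs_of_nonneg h0] at ha
    constructor
    · calc (1 - u) ^ (d + 1 + 1) * (S + y * y)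
          = (1 - u) * ((1 - u) ^ (d + 1) * S + (1 - u) ^ (d + 1) * (y * y)) := by ring
        _ ≤ (1 - u) * (s + F.mul y y) := by gcongr
        _ ≤ _ := by linarith
    · calc _ ≤ (1 + u) * (s + F.mul y y) := by linarith
        _ ≤ (1 + u) * ((1 + u) ^ (d + 1) * S + (1 + u) ^ (d + 1) * (y * y)) := by gcongr
        _ = _ := by ring

/-- A computed normalized vector `r / ‖r‖` has norm `1 + O(u)`, with a constant that depends only on
the dimension. -/
lemma exists_abs_dotProduct_normalized_sub_one_le (n : ℕ) : ∃ C : ℝ, 0 ≤ C ∧ ∃ ε : ℝ, 0 < ε ∧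
    ∀ {u : ℝ} (_ : u ≤ ε) (F : FloatArith u) (r : Fin n → ℝ), flNorm F r ≠ 0 →
      |flDivScalar F r (flNorm F r) ⬝ᵥ flDivScalar F r (flNorm F r) - 1| ≤ C * u := by
  -- the squared norm lies between `g (-u)` and `g u`
  let g : ℝ → ℝ := fun u => (1 + u) ^ 2 / (1 - u) ^ (n + 3)
  have hg : DifferentiableAt ℝ g 0 := by
    refine DifferentiableAt.div (by fun_prop) (by fun_prop) (by simp)
  have hg0 : g 0 = 1 := by simp [g]
  obtain ⟨C, hC⟩ := hg.isBigO_sub.bound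
  obtain ⟨δ, hδ, hC⟩ := Metric.eventually_nhds_iff.1 hC
  simp only [hg0, sub_zero, Real.norm_eq_abs, Real.dist_eq] at hC
  refine ⟨|C|, abs_nonneg _, min (δ / 2) (1 / 2), by positivity, fun {u} huε F r hr => ?_⟩
  have hu := F.nonneg
  have hu1 : u ≤ 1 / 2 := huε.trans (min_le_right _ _)
  have huδ : |u| < δ := by
    rw [abs_of_nonneg hu]; linarith [huε.trans (min_le_left _ _)]
  have hgu : g u ≤ 1 + |C| * u := by
    have := (abs_le.1 (hC huδ)).2
    rw [abs_of_nonneg hu] at this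
    nlinarith [le_abs_self C]
  have hgu' : 1 - |C| * u ≤ g (-u) := by
    have := (abs_le.1 (hC (y := -u) (by rwa [abs_neg]))).1
    rw [abs_neg, abs_of_nonneg hu] at this
    nlinarith [le_abs_self C]
  obtain ⟨d1, d2⟩ := flDot_self_mem F (by linarith) r
  set ν := flNorm F r with hν
  set S := r ⬝ᵥ r with hS
  have hS0 : 0 ≤ S := Finset.sum_nonneg fun i _ => mul_self_nonneg _
  have hl : 0 < 1 - u := by linarith
  have hd0 : 0 ≤ flDot F r r := le_trans (by positivity) d1
  have hsq := abs_le.1 (F.sqrt_err _ hd0)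
  have hν1 : (1 - u) * √(flDot F r r) ≤ ν := by rw [hν, flNorm]; linarith
  have hν2 : ν ≤ (1 + u) * √(flDot F r r) := by rw [hν, flNorm]; linarith
  have hν0 : 0 ≤ ν := le_trans (by positivity) hν1
  have hνpos : 0 < ν := lt_of_le_of_ne hν0 (Ne.symm hr)
  have n1 : (1 - u) ^ (n + 3) * S ≤ ν ^ 2 := by
    calc (1 - u) ^ (n + 3) * S = (1 - u) ^ 2 * ((1 - u) ^ (n + 1) * S) := by ring
      _ ≤ (1 - u) ^ 2 * flDot F r r := by gcongr
      _ = ((1 - u) * √(flDot F r r)) ^ 2 := by rw [mul_pow, Real.sq_sqrt hd0]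
      _ ≤ ν ^ 2 := by gcongr
  have n2 : ν ^ 2 ≤ (1 + u) ^ (n + 3) * S := by
    calc ν ^ 2 ≤ ((1 + u) * √(flDot F r r)) ^ 2 := by gcongr
      _ = (1 + u) ^ 2 * flDot F r r := by rw [mul_pow, Real.sq_sqrt hd0]
      _ ≤ (1 + u) ^ 2 * ((1 + u) ^ (n + 1) * S) := by gcongr
      _ = _ := by ring
  have hSν : ∑ i, (r i / ν) ^ 2 = S / ν ^ 2 := by
    simp_rw [div_pow]
    rw [← Finset.sum_div, hS, dotProduct]
    simp_rw [pow_two]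
  have q1 : ∀ i, (1 - u) ^ 2 * (r i / ν) ^ 2 ≤ flDivScalar F r ν i ^ 2 ∧
      flDivScalar F r ν i ^ 2 ≤ (1 + u) ^ 2 * (r i / ν) ^ 2 := fun i => by
    have h1 := F.div_err (r i) ν hr
    have h2 := abs_abs_sub_abs_le_abs_sub (F.div (r i) ν) (r i / ν)
    have h3 := abs_le.1 (h2.trans h1)
    rw [← mul_pow, ← mul_pow]
    constructor
    · refine sq_le_sq.2 ?_
      rw [abs_mul, abs_of_pos hl, flDivScalar]
      linarith
    · refine sq_le_sq.2 ?_
      rw [abs_mul, abs_of_nonneg (by linarith : 0 ≤ 1 + u), flDivScalar]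
      linarith
  have hqq : flDivScalar F r ν ⬝ᵥ flDivScalar F r ν = ∑ i, flDivScalar F r ν i ^ 2 := by
    simp [dotProduct, pow_two]
  have q2 : (1 - u) ^ 2 * (S / ν ^ 2) ≤ flDivScalar F r ν ⬝ᵥ flDivScalar F r ν := by
    rw [hqq, ← hSν, Finset.mul_sum]
    exact Finset.sum_le_sum fun i _ => (q1 i).1
  have q3 : flDivScalar F r ν ⬝ᵥ flDivScalar F r ν ≤ (1 + u) ^ 2 * (S / ν ^ 2) := by
    rw [hqq, ← hSν, Finset.mul_sum]
    exact Finset.sum_le_sum fun i _ => (q1 i).2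
  have hν2pos : 0 < ν ^ 2 := by positivity
  have b1 : (1 + u) ^ 2 * (S / ν ^ 2) ≤ g u := by
    have : S / ν ^ 2 ≤ 1 / (1 - u) ^ (n + 3) := by
      rw [div_le_div_iff₀ hν2pos (by positivity)]; linarith
    calc _ ≤ (1 + u) ^ 2 * (1 / (1 - u) ^ (n + 3)) := by gcongr
      _ = _ := by simp only [g]; ring
  have b2 : g (-u) ≤ (1 - u) ^ 2 * (S / ν ^ 2) := by
    have : 1 / (1 + u) ^ (n + 3) ≤ S / ν ^ 2 := by
      rw [div_le_div_iff₀ (by positivity) hν2pos]; linarith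
    calc g (-u) = (1 - u) ^ 2 * (1 / (1 + u) ^ (n + 3)) := by
          simp only [g, sub_neg_eq_add, ← sub_eq_add_neg]; ring
      _ ≤ _ := by gcongr
  exact abs_le.2 ⟨by linarith, by linarith⟩

lemma lbfro_q_eq {u : ℝ} (F : FloatArith u) {m n : ℕ} (A : Matrix (Fin m) (Fin n) ℝ)
    (b : Fin m → ℝ) (N j : ℕ) : ∃ r : Fin n → ℝ, (lbfro F A b N j).α = flNorm F r ∧
      (lbfro F A b N j).q = flDivScalar F r (flNorm F r) := by
  cases j with
  | zero => exact ⟨_, rfl, rfl⟩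
  | succ j => exact ⟨_, rfl, rfl⟩

/-! ### The computed Givens rotations -/

lemma ne_zero_of_abs_sub_le {f a v : ℝ} (hv : v < 1) (ha : a ≠ 0) (h : |f - a| ≤ v * |a|) :
    f ≠ 0 := by
  rintro rfl
  have := abs_pos.2 ha
  rw [zero_sub, abs_neg] at h
  nlinarith

lemma sqrt_div_four_le_givensRho {v : ℝ} (D : FloatArith v) (hv : v ≤ 1 / 2) (α β : ℕ → ℝ) (j : ℕ) :
    √((givens D α β j).1 ^ 2 + β (j + 1) ^ 2) / 4 ≤ givensRho D α β j := by
  have hv0 := D.nonneg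
  unfold givensRho
  set a := (givens D α β j).1
  set b := β (j + 1)
  have ha := (abs_le.1 (D.mul_err a a)).1
  have hb := (abs_le.1 (D.mul_err b b)).1
  rw [abs_of_nonneg (mul_self_nonneg _)] at ha hb
  have h1 : (a ^ 2 + b ^ 2) / 2 ≤ D.mul a a + D.mul b b := by nlinarith
  have h2 := (abs_le.1 (D.add_err (D.mul a a) (D.mul b b))).1
  rw [abs_of_nonneg (by nlinarith)] at h2
  have h3 : (a ^ 2 + b ^ 2) / 4 ≤ D.add (D.mul a a) (D.mul b b) := by nlinarith
  have h4 : (0 : ℝ) ≤ (a ^ 2 + b ^ 2) / 4 := by positivity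
  have h5 := (abs_le.1 (D.sqrt_err _ (h4.trans h3))).1
  have h6 : √(a ^ 2 + b ^ 2) / 2 ≤ √(D.add (D.mul a a) (D.mul b b)) := by
    refine Real.le_sqrt_of_sq_le ?_
    rw [div_pow, Real.sq_sqrt (by positivity)]
    linarith
  have h7 := Real.sqrt_nonneg (a ^ 2 + b ^ 2)
  change _ ≤ D.sqrt (D.add (D.mul a a) (D.mul b b))
  nlinarith

lemma givensRho_pos {v : ℝ} (D : FloatArith v) (hv : v ≤ 1 / 2) (α β : ℕ → ℝ) (j : ℕ)
    (h : (givens D α β j).1 ≠ 0) : 0 < givensRho D α β j := by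
  refine lt_of_lt_of_le ?_ (sqrt_div_four_le_givensRho D hv α β j)
  positivity

lemma givens_fst_ne_zero {v : ℝ} (D : FloatArith v) (hv : v ≤ 1 / 2) (α β : ℕ → ℝ) (k : ℕ)
    (hα : ∀ j < k, α j ≠ 0) : ∀ j < k, (givens D α β j).1 ≠ 0 := by
  intro j
  induction j with
  | zero => exact hα 0
  | succ j ih =>
    intro hj
    have h1 := ih (by omega)
    have h2 := (givensRho_pos D hv α β j h1).ne'
    have h3 := ne_zero_of_abs_sub_le (by linarith) (div_ne_zero h1 h2) (D.div_err _ _ h2)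
    exact ne_zero_of_abs_sub_le (by linarith) (mul_ne_zero (neg_ne_zero.2 h3) (hα _ hj))
      (D.mul_err _ _)

lemma givensPhi_zero_ne_zero {v : ℝ} (D : FloatArith v) (hv : v ≤ 1 / 2) (α β : ℕ → ℝ)
    (hα : α 0 ≠ 0) (hβ : β 0 ≠ 0) : givensPhi D α β 0 ≠ 0 := by
  have h2 := (givensRho_pos D hv α β 0 hα).ne'
  have h3 := ne_zero_of_abs_sub_le (by linarith) (div_ne_zero hα h2) (D.div_err _ _ h2)
  exact ne_zero_of_abs_sub_le (by linarith) (mul_ne_zero h3 hβ) (D.mul_err _ _)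

/-- The computed superdiagonal entries are bounded in terms of the Lanczos coefficients alone:
`ρ_j` dominates `β_{j+1}`, hence the computed sine is bounded. -/
lemma abs_givensTheta_div_givensRho_le {v : ℝ} (D : FloatArith v) (hv : v ≤ 1 / 2) (α β : ℕ → ℝ)
    (j : ℕ) (hβ : β (j + 1) ≠ 0) :
    |givensTheta D α β j / givensRho D α β j| ≤ 36 * |α (j + 1)| / |β (j + 1)| := by
  have hv0 := D.nonneg
  have hb : 0 < |β (j + 1)| := abs_pos.2 hβ
  have h1 : |β (j + 1)| / 4 ≤ givensRho D α β j := by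
    refine le_trans ?_ (sqrt_div_four_le_givensRho D hv α β j)
    have : |β (j + 1)| ≤ √((givens D α β j).1 ^ 2 + β (j + 1) ^ 2) :=
      Real.abs_le_sqrt (by nlinarith [sq_nonneg (givens D α β j).1])
    linarith
  unfold givensTheta
  set ρ := givensRho D α β j
  have hρ : 0 < ρ := by linarith
  have key : ∀ {f a : ℝ}, |f - a| ≤ v * |a| → |f| ≤ 3 / 2 * |a| := by
    intro f a h
    have := abs_add_le (f - a) a
    rw [sub_add_cancel] at this
    nlinarith [abs_nonneg a]
  have h2 := key (D.div_err (β (j + 1)) ρ hρ.ne')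
  have h3 := key (D.mul_err (D.div (β (j + 1)) ρ) (α (j + 1)))
  have h4 : |β (j + 1) / ρ| ≤ 4 := by
    rw [abs_div, abs_of_pos hρ, div_le_iff₀ hρ]; linarith
  have h5 : |D.mul (D.div (β (j + 1)) ρ) (α (j + 1))| ≤ 9 * |α (j + 1)| := by
    rw [abs_mul] at h3
    nlinarith [abs_nonneg (α (j + 1))]
  rw [abs_div, abs_of_pos hρ, div_le_div_iff₀ hρ hb]
  have h6 := mul_le_mul h5 h1 (by positivity) (by positivity)
  linarith

lemma scaledR_eq_bidiag {u v : ℝ} (F : FloatArith u) (D : FloatArith v) {m n : ℕ}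
    (A : Matrix (Fin m) (Fin n) ℝ) (b : Fin m → ℝ) (N k : ℕ) :
    scaledR F D A b N k = bidiag (fun j =>
      givensTheta D (fun j => (lbfro F A b N j).α) (fun j => (lbfro F A b N j).β) j /
      givensRho D (fun j => (lbfro F A b N j).α) (fun j => (lbfro F A b N j).β) j) k := rfl

lemma roundoff_double_le : ((2 : ℝ)⁻¹ ^ 53) ≤ 1 / 2 := by norm_num

/-- The error bound for a uniform family of executions: the constants depend only on `k`, on the
constant `c` of near orthonormality and on the bound `K` of the condition number. -/
lemma exists_updateErrorBound_iterate (k : ℕ) (hk : 0 < k) (c K : ℝ) (hc : 0 ≤ c) :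
    ∃ C : ℝ, 0 < C ∧ ∃ ε : ℝ, 0 < ε ∧
    ∀ {m n : ℕ} {A : Matrix (Fin m) (Fin n) ℝ} {b : Fin m → ℝ} {N : ℕ} {u ubar : ℝ}
      (_ : u ≤ ε) (_ : ubar ≤ ε) (F : FloatArith u) (D : FloatArith ((2 : ℝ)⁻¹ ^ 53))
      (G : FloatArith ubar), NoBreakdown F A b N k →
      (∀ i < k, ∀ j < k, |(lbfro F A b N i).q ⬝ᵥ (lbfro F A b N j).q - if i = j then 1 else 0|
        ≤ c * u) →
      cond (scaledR F D A b N k) ≤ K →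
      UpdateErrorBound (iterate F D G A b N k) (iterate F D exactArith A b N k) k
        (cond (scaledR F D A b N k)) u ubar C := by
  obtain ⟨C, hC, ε, hε, h⟩ := exists_updateErrorBound k hk c K hc
  refine ⟨C, hC, ε, hε, ?_⟩
  intro m n A b N u ubar hu hubar F D G hNB hq hK
  exact h F.nonneg hu hubar G (fun j => (lbfro F A b N j).q) _ _ _
    (fun j hj => (givensRho_pos D roundoff_double_le _ _ j
      (givens_fst_ne_zero D roundoff_double_le _ _ k (fun j hj => (hNB j hj).1) j hj)).ne')
    (givensPhi_zero_ne_zero D roundoff_double_le _ _ (hNB 0 hk).1 (hNB 0 hk).2) hq hK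

lemma abs_dotProduct_le_orthLevel {u : ℝ} (F : FloatArith u) {m n : ℕ}
    (A : Matrix (Fin m) (Fin n) ℝ) (b : Fin m → ℝ) (N : ℕ) {k i j : ℕ} (hij : i < j) (hj : j < k) :
    |(lbfro F A b N i).q ⬝ᵥ (lbfro F A b N j).q| ≤ orthLevel F A b N k := by
  have h := abs_apply_le_specNorm (Matrix.of fun i j : Fin k =>
    if i < j then ((1 : Matrix (Fin k) (Fin k) ℝ) -
      (Matrix.of fun (a : Fin n) (j : Fin k) => (lbfro F A b N j).q a)ᵀ *
      (Matrix.of fun (a : Fin n) (j : Fin k) => (lbfro F A b N j).q a)) i j else 0)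
    ⟨i, hij.trans hj⟩ ⟨j, hj⟩
  refine le_trans (le_of_eq ?_) h
  simp [hij, hij.ne, Matrix.one_apply, Matrix.mul_apply, dotProduct]

open Filter Topology Asymptotics

/-! ### Perturbation of computed quantities for small roundoff units -/

/-- An arithmetic together with its roundoff unit. -/
abbrev Arith := Σ u : ℝ, FloatArith u

/-- The filter of arithmetics whose roundoff unit tends to zero. -/
def smallRoundoff : Filter Arith := comap Sigma.fst (𝓝 0)

/-- The computed number `f`, a function of the arithmetic, equals `a` up to `O(u)`. -/
def Near (f : Arith → ℝ) (a : ℝ) : Prop :=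
  (fun e => f e - a) =O[smallRoundoff] fun e : Arith => e.1

lemma tendsto_roundoff : Tendsto (fun e : Arith => e.1) smallRoundoff (𝓝 0) := tendsto_comap

lemma Near.tendsto {f : Arith → ℝ} {a : ℝ} (h : Near f a) : Tendsto f smallRoundoff (𝓝 a) := by
  have := (h.trans_tendsto tendsto_roundoff).add_const a
  simpa using this

lemma Near.const (a : ℝ) : Near (fun _ => a) a := by
  simp [Near, isBigO_zero]

lemma Near.comp {f : Arith → ℝ} {a : ℝ} (hf : Near f a) {g : ℝ → ℝ}
    (hg : DifferentiableAt ℝ g a) : Near (fun e => g (f e)) (g a) :=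
  (hg.isBigO_sub.comp_tendsto hf.tendsto).trans hf

lemma Near.exact_add {f g : Arith → ℝ} {a b : ℝ} (hf : Near f a) (hg : Near g b) :
    Near (fun e => f e + g e) (a + b) :=
  (IsBigO.add hf hg).congr_left fun e => by ring

lemma Near.exact_neg {f : Arith → ℝ} {a : ℝ} (hf : Near f a) :
    Near (fun e => -f e) (-a) :=
  (IsBigO.neg_left hf).congr_left fun e => by ring

lemma Near.exact_mul {f g : Arith → ℝ} {a b : ℝ} (hf : Near f a) (hg : Near g b) :
    Near (fun e => f e * g e) (a * b) := by
  have h1 : (fun e => (f e - a) * g e) =O[smallRoundoff] fun e : Arith => e.1 := by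
    simpa using IsBigO.mul hf (hg.tendsto.isBigO_one ℝ)
  have h2 : (fun e => a * (g e - b)) =O[smallRoundoff] fun e : Arith => e.1 :=
    IsBigO.const_mul_left hg a
  exact (h1.add h2).congr_left fun e => by ring

lemma Near.exact_div {f g : Arith → ℝ} {a b : ℝ} (hf : Near f a) (hg : Near g b) (hb : b ≠ 0) :
    Near (fun e => f e / g e) (a / b) := by
  simp_rw [div_eq_mul_inv]
  exact hf.exact_mul (hg.comp (differentiableAt_inv hb))

lemma Near.exact_sum {ι : Type*} (s : Finset ι) {f : ι → Arith → ℝ} {a : ι → ℝ}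
    (h : ∀ i ∈ s, Near (f i) (a i)) : Near (fun e => ∑ i ∈ s, f i e) (∑ i ∈ s, a i) := by
  refine (IsBigO.sum h).congr_left fun e => ?_
  rw [Finset.sum_apply, Finset.sum_sub_distrib]

/-- Rounding errors preserve nearness. -/
lemma Near.of_relative_error {f g : Arith → ℝ} {a : ℝ} (hf : Near f a)
    (h : ∀ᶠ e in smallRoundoff, |g e - f e| ≤ e.1 * |f e|) : Near g a := by
  have h1 : (fun e => g e - f e) =O[smallRoundoff] fun e => e.1 * f e := by
    refine IsBigO.of_bound 1 (h.mono fun e he => ?_)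
    rw [one_mul, Real.norm_eq_abs, Real.norm_eq_abs, abs_mul, abs_of_nonneg e.2.nonneg]
    exact he
  have h2 : (fun e => e.1 * f e) =O[smallRoundoff] fun e : Arith => e.1 := by
    simpa using (isBigO_refl (fun e : Arith => e.1) smallRoundoff).mul
      (hf.tendsto.isBigO_one ℝ)
  exact ((h1.trans h2).add hf).congr_left fun e => by ring

lemma Near.add {f g : Arith → ℝ} {a b : ℝ} (hf : Near f a) (hg : Near g b) :
    Near (fun e => e.2.add (f e) (g e)) (exactArith.add a b) :=
  (hf.exact_add hg).of_relative_error (.of_forall fun e => e.2.add_err _ _)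

lemma Near.sub {f g : Arith → ℝ} {a b : ℝ} (hf : Near f a) (hg : Near g b) :
    Near (fun e => e.2.sub (f e) (g e)) (exactArith.sub a b) := by
  have h : Near (fun e => f e - g e) (a - b) := by
    simpa [sub_eq_add_neg] using hf.exact_add hg.exact_neg
  exact h.of_relative_error (.of_forall fun e => e.2.sub_err _ _)

lemma Near.mul {f g : Arith → ℝ} {a b : ℝ} (hf : Near f a) (hg : Near g b) :
    Near (fun e => e.2.mul (f e) (g e)) (exactArith.mul a b) :=
  (hf.exact_mul hg).of_relative_error (.of_forall fun e => e.2.mul_err _ _)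

lemma Near.div {f g : Arith → ℝ} {a b : ℝ} (hf : Near f a) (hg : Near g b) (hb : b ≠ 0) :
    Near (fun e => e.2.div (f e) (g e)) (exactArith.div a b) :=
  (hf.exact_div hg hb).of_relative_error
    ((hg.tendsto.eventually_ne hb).mono fun e he => e.2.div_err _ _ he)

lemma Near.sqrt {f : Arith → ℝ} {a : ℝ} (hf : Near f a) (ha : 0 < a) :
    Near (fun e => e.2.sqrt (f e)) (exactArith.sqrt a) := by
  refine (hf.comp (g := Real.sqrt) (Real.hasDerivAt_sqrt ha.ne').differentiableAt)
    |>.of_relative_error ((hf.tendsto.eventually_const_lt ha).mono fun e he => ?_)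
  rw [abs_of_nonneg (Real.sqrt_nonneg _)]
  exact e.2.sqrt_err _ he.le

/-- The computed vector `f` equals `v` up to `O(u)`. -/
def NearVec {d : ℕ} (f : Arith → Fin d → ℝ) (v : Fin d → ℝ) : Prop :=
  ∀ i, Near (fun e => f e i) (v i)

/-- The computed list of vectors has constant length and equals the given one up to `O(u)`. -/
inductive NearList {d : ℕ} : (Arith → List (Fin d → ℝ)) → List (Fin d → ℝ) → Prop
  | nil : NearList (fun _ => []) []
  | cons {f : Arith → Fin d → ℝ} {v : Fin d → ℝ} {L : Arith → List (Fin d → ℝ)}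
      {L₀ : List (Fin d → ℝ)} :
      NearVec f v → NearList L L₀ → NearList (fun e => f e :: L e) (v :: L₀)

lemma near_flDot {d : ℕ} {f g : Arith → Fin d → ℝ} {x y : Fin d → ℝ} (hf : NearVec f x)
    (hg : NearVec g y) : Near (fun e => flDot e.2 (f e) (g e)) (flDot exactArith x y) := by
  induction d with
  | zero => simpa [flDot] using Near.const 0
  | succ d ih =>
    simp_rw [flDot_succ]
    exact (ih (fun i => hf i.castSucc) (fun i => hg i.castSucc)).add ((hf _).mul (hg _))

lemma nearVec_flMulVec {d k : ℕ} (M : Matrix (Fin d) (Fin k) ℝ) {f : Arith → Fin k → ℝ}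
    {x : Fin k → ℝ} (hf : NearVec f x) :
    NearVec (fun e => flMulVec e.2 M (f e)) (flMulVec exactArith M x) :=
  fun i => near_flDot (fun j => Near.const (M i j)) hf

lemma flDot_exact {d : ℕ} (x y : Fin d → ℝ) : flDot exactArith x y = x ⬝ᵥ y := by
  induction d with
  | zero => simp [flDot]
  | succ d ih =>
    rw [flDot_succ, ih]
    simp [exactArith, dotProduct, Fin.sum_univ_castSucc]

lemma flNorm_exact {d : ℕ} (x : Fin d → ℝ) : flNorm exactArith x = √(x ⬝ᵥ x) := by
  rw [flNorm, flDot_exact]; rfl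

lemma near_flNorm {d : ℕ} {f : Arith → Fin d → ℝ} {x : Fin d → ℝ} (hf : NearVec f x)
    (hx : flNorm exactArith x ≠ 0) :
    Near (fun e => flNorm e.2 (f e)) (flNorm exactArith x) := by
  refine (near_flDot hf hf).sqrt ?_
  rw [flNorm_exact] at hx
  rw [flDot_exact]
  exact Real.sqrt_pos.1 (lt_of_le_of_ne (Real.sqrt_nonneg _) (Ne.symm hx))

lemma nearVec_flDivScalar {d : ℕ} {f : Arith → Fin d → ℝ} {x : Fin d → ℝ} {g : Arith → ℝ} {c : ℝ}
    (hf : NearVec f x) (hg : Near g c) (hc : c ≠ 0) :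
    NearVec (fun e => flDivScalar e.2 (f e) (g e)) (flDivScalar exactArith x c) :=
  fun i => (hf i).div hg hc

lemma nearVec_flSubSmul {d : ℕ} {f h : Arith → Fin d → ℝ} {x y : Fin d → ℝ} {g : Arith → ℝ} {c : ℝ}
    (hf : NearVec f x) (hg : Near g c) (hh : NearVec h y) :
    NearVec (fun e => flSubSmul e.2 (f e) (g e) (h e)) (flSubSmul exactArith x c y) :=
  fun i => (hf i).sub (hg.mul (hh i))

lemma nearVec_flSweep {d : ℕ} {L : Arith → List (Fin d → ℝ)} {L₀ : List (Fin d → ℝ)}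
    (hL : NearList L L₀) {f : Arith → Fin d → ℝ} {x : Fin d → ℝ} (hf : NearVec f x) :
    NearVec (fun e => flSweep e.2 (L e) (f e)) (flSweep exactArith L₀ x) := by
  induction hL with
  | nil => exact hf
  | cons hv _ ih => exact nearVec_flSubSmul ih (near_flDot hv ih) hv

lemma nearVec_flSweep_iterate {d : ℕ} {L : Arith → List (Fin d → ℝ)} {L₀ : List (Fin d → ℝ)}
    (hL : NearList L L₀) {f : Arith → Fin d → ℝ} {x : Fin d → ℝ} (hf : NearVec f x) (N : ℕ) :
    NearVec (fun e => (flSweep e.2 (L e))^[N] (f e)) ((flSweep exactArith L₀)^[N] x) := by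
  induction N with
  | zero => exact hf
  | succ N ih =>
    simp_rw [Function.iterate_succ_apply']
    exact nearVec_flSweep hL ih

/-- The components of a computed Lanczos state equal those of the given one up to `O(u)`. -/
structure NearState {m n : ℕ} (S : Arith → LanczosState m n) (S₀ : LanczosState m n) : Prop where
  p : NearVec (fun e => (S e).p) S₀.p
  q : NearVec (fun e => (S e).q) S₀.q
  α : Near (fun e => (S e).α) S₀.α
  β : Near (fun e => (S e).β) S₀.β
  ps : NearList (fun e => (S e).ps) S₀.ps
  qs : NearList (fun e => (S e).qs) S₀.qs

variable {m n : ℕ} (A : Matrix (Fin m) (Fin n) ℝ) (b : Fin m → ℝ) (N : ℕ)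

/-- The computed Lanczos quantities depend stably on the rounding errors as long as no exact
coefficient vanishes, so that divisions and square roots are differentiable at the exact values. -/
lemma nearState_lbfro {k : ℕ} (h : NoBreakdown exactArith A b N k) :
    ∀ j < k, NearState (fun e => lbfro e.2 A b N j) (lbfro exactArith A b N j) := by
  intro j
  induction j with
  | zero =>
    intro hj
    obtain ⟨hα, hβ⟩ := h 0 hj
    have hb := near_flNorm (fun i => Near.const (b i)) hβ
    have hp := nearVec_flDivScalar (fun i => Near.const (b i)) hb hβ
    have hr := nearVec_flMulVec Aᵀ hp
    have ha := near_flNorm hr hα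
    have hq := nearVec_flDivScalar hr ha hα
    exact ⟨hp, hq, ha, hb, .cons hp .nil, .cons hq .nil⟩
  | succ j ih =>
    intro hj
    have hS := ih (by omega)
    obtain ⟨hα, hβ⟩ := h (j + 1) hj
    have hs := nearVec_flSweep_iterate hS.ps
      (nearVec_flSubSmul (nearVec_flMulVec A hS.q) hS.α hS.p) N
    have hb := near_flNorm hs hβ
    have hp := nearVec_flDivScalar hs hb hβ
    have hr := nearVec_flSweep_iterate hS.qs
      (nearVec_flSubSmul (nearVec_flMulVec Aᵀ hp) hb hS.q) N
    have ha := near_flNorm hr hα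
    have hq := nearVec_flDivScalar hr ha hα
    exact ⟨hp, hq, ha, hb, .cons hp hS.ps, .cons hq hS.qs⟩

/-! ### Orthonormality of the exact Lanczos vectors -/

/-- One exact sweep against orthonormal vectors produces a vector orthogonal to all of them. -/
lemma dotProduct_flSweep_exact {d : ℕ} {L : List (Fin d → ℝ)}
    (hL : L.Pairwise fun v w => v ⬝ᵥ w = 0) (h1 : ∀ v ∈ L, v ⬝ᵥ v = 1) (r : Fin d → ℝ) :
    ∀ v ∈ L, v ⬝ᵥ flSweep exactArith L r = 0 := by
  induction L with
  | nil => simp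
  | cons w L ih =>
    rw [List.pairwise_cons] at hL
    have ih := ih hL.2 fun v hv => h1 v (List.mem_cons_of_mem _ hv)
    set r' := flSweep exactArith L r with hr'
    have hstep : flSweep exactArith (w :: L) r = r' - (w ⬝ᵥ r') • w := by
      rw [← flDot_exact]; rfl
    intro v hv
    rw [hstep, dotProduct_sub, dotProduct_smul]
    rcases List.mem_cons.1 hv with rfl | hv
    · rw [h1 v hv]; simp
    · rw [ih v hv, dotProduct_comm v w, hL.1 v hv]; simp

lemma dotProduct_flDivScalar_exact {d : ℕ} {r : Fin d → ℝ} (hr : flNorm exactArith r ≠ 0) :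
    flDivScalar exactArith r (flNorm exactArith r) ⬝ᵥ
      flDivScalar exactArith r (flNorm exactArith r) = 1 := by
  have h : flDivScalar exactArith r (flNorm exactArith r) = (flNorm exactArith r)⁻¹ • r := by
    ext i; simp [flDivScalar, exactArith, div_eq_inv_mul]
  rw [h, smul_dotProduct, dotProduct_smul, smul_eq_mul, smul_eq_mul]
  have h0 : flNorm exactArith r * flNorm exactArith r = r ⬝ᵥ r := by
    rw [flNorm_exact]
    exact Real.mul_self_sqrt (Finset.sum_nonneg fun i _ => mul_self_nonneg _)
  rw [← h0]
  field_simp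

lemma dotProduct_flDivScalar_eq_zero {d : ℕ} {v r : Fin d → ℝ} (c : ℝ) (h : v ⬝ᵥ r = 0) :
    v ⬝ᵥ flDivScalar exactArith r c = 0 := by
  have h' : flDivScalar exactArith r c = c⁻¹ • r := by
    ext i; simp [flDivScalar, exactArith, div_eq_inv_mul]
  rw [h', dotProduct_smul, h, smul_zero]

lemma orthonormal_lbfro_exact (hN : 1 ≤ N) {k : ℕ} (h : NoBreakdown exactArith A b N k) :
    ∀ j < k, ((lbfro exactArith A b N j).qs.Pairwise fun v w => v ⬝ᵥ w = 0) ∧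
      ∀ v ∈ (lbfro exactArith A b N j).qs, v ⬝ᵥ v = 1 := by
  intro j
  induction j with
  | zero =>
    intro hj
    refine ⟨List.pairwise_singleton _ _, fun v hv => ?_⟩
    rw [List.mem_singleton.1 hv]
    exact dotProduct_flDivScalar_exact (h 0 hj).1
  | succ j ih =>
    intro hj
    obtain ⟨h1, h2⟩ := ih (by omega)
    obtain ⟨N, rfl⟩ : ∃ N', N = N' + 1 := ⟨N - 1, by omega⟩
    refine ⟨List.pairwise_cons.2 ⟨fun v hv => ?_, h1⟩, fun v hv => ?_⟩
    · rw [dotProduct_comm, Function.iterate_succ_apply']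
      exact dotProduct_flDivScalar_eq_zero _ (dotProduct_flSweep_exact h1 h2 _ v hv)
    · rcases List.mem_cons.1 hv with rfl | hv
      · exact dotProduct_flDivScalar_exact (h (j + 1) hj).1
      · exact h2 v hv

lemma q_mem_qs {u : ℝ} (F : FloatArith u) {i j : ℕ} (hij : i ≤ j) :
    (lbfro F A b N i).q ∈ (lbfro F A b N j).qs := by
  induction j with
  | zero =>
    obtain rfl : i = 0 := by omega
    exact List.mem_cons_self
  | succ j ih =>
    rcases Nat.of_le_succ hij with h | rfl
    · exact List.mem_cons_of_mem _ (ih h)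
    · exact List.mem_cons_self

lemma dotProduct_q_exact (hN : 1 ≤ N) {k : ℕ} (h : NoBreakdown exactArith A b N k) {i j : ℕ}
    (hi : i < k) (hj : j < k) :
    (lbfro exactArith A b N i).q ⬝ᵥ (lbfro exactArith A b N j).q = if i = j then 1 else 0 := by
  have key : ∀ {i j : ℕ}, i < j → j < k →
      (lbfro exactArith A b N j).q ⬝ᵥ (lbfro exactArith A b N i).q = 0 := by
    intro i j hij hj
    obtain ⟨j, rfl⟩ : ∃ j', j = j' + 1 := ⟨j - 1, by omega⟩
    exact List.rel_of_pairwise_cons (orthonormal_lbfro_exact A b N hN h _ hj).1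
      (q_mem_qs A b N exactArith (Nat.le_of_lt_succ hij))
  rcases lt_trichotomy i j with hij | rfl | hij
  · rw [dotProduct_comm, key hij hj, if_neg hij.ne]
  · rw [if_pos rfl]
    exact (orthonormal_lbfro_exact A b N hN h i hi).2 _ (q_mem_qs A b N exactArith le_rfl)
  · rw [key hij hi, if_neg hij.ne']

/-! ### Bounds for a fixed problem -/

/-- The condition numbers of unit bidiagonal matrices with bounded entries are bounded: they are
values of a continuous function on a compact set, since the inverse is the adjugate. -/
lemma exists_cond_bidiag_le (k : ℕ) (T : ℝ) : ∃ K : ℝ, ∀ t : ℕ → ℝ,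
    (∀ j, j + 1 < k → |t j| ≤ T) → cond (bidiag t k) ≤ K := by
  have hcont : Continuous (specNorm : Matrix (Fin k) (Fin k) ℝ → ℝ) := by
    let L : Matrix (Fin k) (Fin k) ℝ →ₗ[ℝ]
        (EuclideanSpace ℝ (Fin k) →L[ℝ] EuclideanSpace ℝ (Fin k)) :=
      { toFun := Matrix.toEuclideanCLM (𝕜 := ℝ)
        map_add' := map_add _
        map_smul' := map_smul _ }
    exact (LinearMap.continuous_of_finiteDimensional L).norm
  have hcomp : IsCompact (Set.univ.pi fun _ : Fin k => Set.univ.pi fun _ : Fin k =>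
      Set.Icc (-max T 1) (max T 1)) :=
    isCompact_univ_pi fun _ => isCompact_univ_pi fun _ => isCompact_Icc
  obtain ⟨K, hK⟩ := hcomp.exists_bound_of_continuousOn
    (f := fun M : Matrix (Fin k) (Fin k) ℝ => specNorm M * specNorm M.adjugate)
    (hcont.mul (hcont.comp (continuous_id.matrix_adjugate))).continuousOn
  refine ⟨K, fun t ht => ?_⟩
  have h1 : (bidiag t k)⁻¹ = (bidiag t k).adjugate := by
    rw [Matrix.inv_def, det_bidiag]; simp
  have h2 := hK (bidiag t k) ?_
  · rw [cond, h1]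
    exact (le_abs_self _).trans h2
  · intro i _ j _
    refine abs_le.1 ?_
    by_cases hij : i = j
    · simp [bidiag, hij]
    · by_cases hij' : (i : ℕ) + 1 = j
      · simp only [bidiag, Matrix.of_apply, if_neg hij, if_pos hij']
        exact (ht i (hij' ▸ j.2)).trans (le_max_left _ _)
      · simp [bidiag, hij, hij']

lemma eventually_smallRoundoff {P : Arith → Prop} (h : ∀ᶠ e in smallRoundoff, P e) :
    ∃ ε : ℝ, 0 < ε ∧ ∀ u ≤ ε, ∀ F : FloatArith u, P ⟨u, F⟩ := by
  obtain ⟨ε, hε, h⟩ := Metric.eventually_nhds_iff.1 (eventually_comap.1 h)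
  refine ⟨ε / 2, by positivity, fun u hu F => h ?_ ⟨u, F⟩ rfl⟩
  rw [Real.dist_eq, sub_zero, abs_of_nonneg F.nonneg]
  linarith

lemma single_le_sum_sum {k i j : ℕ} (f : ℕ → ℕ → ℝ) (hf : ∀ i j, 0 ≤ f i j) (hi : i < k)
    (hj : j < k) : f i j ≤ ∑ i ∈ Finset.range k, ∑ j ∈ Finset.range k, f i j :=
  (Finset.single_le_sum (fun j _ => hf i j) (Finset.mem_range.2 hj)).trans
    (Finset.single_le_sum (f := fun i => ∑ j ∈ Finset.range k, f i j)
      (fun i _ => Finset.sum_nonneg fun j _ => hf i j) (Finset.mem_range.2 hi))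

/-- For a fixed problem the exact iteration of which does not break down, the computed quantities
satisfy the hypotheses of the uniform error bound once the roundoff unit is small. -/
lemma exists_uniform_bounds (hN : 1 ≤ N) {k : ℕ} (h : NoBreakdown exactArith A b N k) :
    ∃ c : ℝ, 0 ≤ c ∧ ∃ K : ℝ, ∃ ε : ℝ, 0 < ε ∧ ∀ u ≤ ε, ∀ F : FloatArith u,
      NoBreakdown F A b N k ∧
      (∀ i < k, ∀ j < k, |(lbfro F A b N i).q ⬝ᵥ (lbfro F A b N j).q - if i = j then 1 else 0|
        ≤ c * u) ∧
      ∀ D : FloatArith ((2 : ℝ)⁻¹ ^ 53), cond (scaledR F D A b N k) ≤ K := by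
  have hS := nearState_lbfro A b N h
  have hfin : {j : ℕ | j < k}.Finite := Set.finite_lt_nat k
  have hNB : ∀ᶠ e : Arith in smallRoundoff, NoBreakdown e.2 A b N k :=
    (eventually_all_finite hfin).2 fun j hj =>
      ((hS j hj).α.tendsto.eventually_ne (h j hj).1).and
        ((hS j hj).β.tendsto.eventually_ne (h j hj).2)
  have hdot : ∀ i < k, ∀ j < k, Near (fun e => (lbfro e.2 A b N i).q ⬝ᵥ (lbfro e.2 A b N j).q)
      (if i = j then 1 else 0) := fun i hi j hj => by
    rw [← dotProduct_q_exact A b N hN h hi hj]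
    exact Near.exact_sum _ fun a _ => ((hS i hi).q a).exact_mul ((hS j hj).q a)
  have hsum : (fun e : Arith => ∑ i ∈ Finset.range k, ∑ j ∈ Finset.range k,
      |(lbfro e.2 A b N i).q ⬝ᵥ (lbfro e.2 A b N j).q - if i = j then 1 else 0|)
      =O[smallRoundoff] fun e : Arith => e.1 := by
    refine (IsBigO.sum fun i hi => IsBigO.sum fun j hj => (isBigO_norm_left.2
      (hdot i (Finset.mem_range.1 hi) j (Finset.mem_range.1 hj)))).congr_left fun e => ?_
    simp only [Finset.sum_apply, Real.norm_eq_abs]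
  obtain ⟨c, hc⟩ := hsum.bound
  obtain ⟨T, hTj⟩ : ∃ T : ℝ, ∀ j < k, 36 * (|(lbfro exactArith A b N (j + 1)).α| + 1) /
      (|(lbfro exactArith A b N (j + 1)).β| / 2) ≤ T := by
    obtain ⟨T, hT⟩ := (hfin.image fun j => 36 * (|(lbfro exactArith A b N (j + 1)).α| + 1) /
      (|(lbfro exactArith A b N (j + 1)).β| / 2)).bddAbove
    exact ⟨T, fun j hj => hT (Set.mem_image_of_mem _ hj)⟩
  obtain ⟨K, hK⟩ := exists_cond_bidiag_le k T
  have hcoef : ∀ᶠ e : Arith in smallRoundoff, ∀ j ∈ {j : ℕ | j < k},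
      |(lbfro e.2 A b N j).α| ≤ |(lbfro exactArith A b N j).α| + 1 ∧
      |(lbfro exactArith A b N j).β| / 2 ≤ |(lbfro e.2 A b N j).β| :=
    (eventually_all_finite hfin).2 fun j hj =>
      ((hS j hj).α.tendsto.abs.eventually_le_const (by linarith)).and
        ((hS j hj).β.tendsto.abs.eventually_const_le
          (half_lt_self (abs_pos.2 (h j hj).2)))
  obtain ⟨ε, hε, hall⟩ := eventually_smallRoundoff (hNB.and (hc.and hcoef))
  refine ⟨|c|, abs_nonneg c, K, ε, hε, fun u hu F => ?_⟩
  obtain ⟨h1, h2, h3⟩ := hall u hu F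
  refine ⟨h1, fun i hi j hj => ?_, fun D => scaledR_eq_bidiag F D A b N k ▸ hK _ fun j hj => ?_⟩
  · have hu0 := F.nonneg
    have h4 := single_le_sum_sum (fun i j =>
      |(lbfro F A b N i).q ⬝ᵥ (lbfro F A b N j).q - if i = j then 1 else 0|)
      (fun _ _ => abs_nonneg _) hi hj
    rw [Real.norm_eq_abs, Real.norm_eq_abs, abs_of_nonneg hu0] at h2
    have h5 : c * u ≤ |c| * u := mul_le_mul_of_nonneg_right (le_abs_self c) hu0
    exact (h4.trans (le_abs_self _)).trans (h2.trans h5)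
  · obtain ⟨a1, a2⟩ := h3 (j + 1) hj
    have hβ : 0 < |(lbfro exactArith A b N (j + 1)).β| := abs_pos.2 (h (j + 1) hj).2
    refine (abs_givensTheta_div_givensRho_le D roundoff_double_le _ _ j
      (h1 (j + 1) hj).2).trans ?_
    refine le_trans ?_ (hTj j (by omega))
    exact div_le_div₀ (by positivity) (by linarith) (by positivity) a2

end MixedLSQR

end

theorem mainTheorem2 :
    -- for a fixed problem on which the exact iteration does not terminate before step `k`
    (∀ (m n : ℕ) (A : Matrix (Fin m) (Fin n) ℝ) (b : Fin m → ℝ) (N k : ℕ), 1 ≤ N → 1 ≤ k →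
      MixedLSQR.NoBreakdown MixedLSQR.exactArith A b N k →
      ∃ C : ℝ, 0 < C ∧ ∃ ε : ℝ, 0 < ε ∧
        ∀ (u ubar : ℝ), u ≤ ε → ubar ≤ ε →
        ∀ (F : MixedLSQR.FloatArith u) (D : MixedLSQR.FloatArith ((2 : ℝ)⁻¹ ^ 53))
          (G : MixedLSQR.FloatArith ubar),
          MixedLSQR.UpdateErrorBound
            (MixedLSQR.iterate F D G A b N k)
            (MixedLSQR.iterate F D MixedLSQR.exactArith A b N k)
            k (MixedLSQR.cond (MixedLSQR.scaledR F D A b N k)) u ubar C) ∧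
    -- uniformly over all problems, in terms of the size of `κ(R̂_k)` and of the orthogonality level
    (∀ (n k : ℕ) (c K : ℝ), 1 ≤ k →
      ∃ C : ℝ, 0 < C ∧ ∃ ε : ℝ, 0 < ε ∧
        ∀ (m : ℕ) (A : Matrix (Fin m) (Fin n) ℝ) (b : Fin m → ℝ) (N : ℕ), 1 ≤ N →
        ∀ (u ubar : ℝ), u ≤ ε → ubar ≤ ε →
        ∀ (F : MixedLSQR.FloatArith u) (D : MixedLSQR.FloatArith ((2 : ℝ)⁻¹ ^ 53))
          (G : MixedLSQR.FloatArith ubar),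
          MixedLSQR.NoBreakdown F A b N k →
          MixedLSQR.orthLevel F A b N k ≤ c * u →
          MixedLSQR.cond (MixedLSQR.scaledR F D A b N k) ≤ K →
          MixedLSQR.UpdateErrorBound
            (MixedLSQR.iterate F D G A b N k)
            (MixedLSQR.iterate F D MixedLSQR.exactArith A b N k)
            k (MixedLSQR.cond (MixedLSQR.scaledR F D A b N k)) u ubar C) := by
  constructor
  · intro m n A b N k hN hk h
    obtain ⟨c, hc, K, ε₁, hε₁, h₁⟩ := MixedLSQR.exists_uniform_bounds A b N hN h
    obtain ⟨C, hC, ε₂, hε₂, h₂⟩ := MixedLSQR.exists_updateErrorBound_iterate k hk c K hc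
    refine ⟨C, hC, min ε₁ ε₂, lt_min hε₁ hε₂, fun u ubar hu hubar F D G => ?_⟩
    obtain ⟨hNB, hq, hK⟩ := h₁ u (hu.trans (min_le_left _ _)) F
    exact h₂ (hu.trans (min_le_right _ _)) (hubar.trans (min_le_right _ _)) F D G hNB hq (hK D)
  · intro n k c K hk
    obtain ⟨C₁, hC₁, ε₁, hε₁, h₁⟩ := MixedLSQR.exists_abs_dotProduct_normalized_sub_one_le n
    obtain ⟨C, hC, ε₂, hε₂, h₂⟩ := MixedLSQR.exists_updateErrorBound_iterate k hk (max c C₁) K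
      (hC₁.trans (le_max_right _ _))
    refine ⟨C, hC, min ε₁ ε₂, lt_min hε₁ hε₂, ?_⟩
    intro m A b N _ u ubar hu hubar F D G hNB horth hK
    refine h₂ (hu.trans (min_le_right _ _)) (hubar.trans (min_le_right _ _)) F D G hNB ?_ hK
    intro i hi j hj
    have hu0 := F.nonneg
    have hoff : ∀ {i j : ℕ}, i < j → j < k →
        |(MixedLSQR.lbfro F A b N i).q ⬝ᵥ (MixedLSQR.lbfro F A b N j).q| ≤ max c C₁ * u :=
      fun hij hj => ((MixedLSQR.abs_dotProduct_le_orthLevel F A b N hij hj).trans horth).trans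
        (mul_le_mul_of_nonneg_right (le_max_left _ _) hu0)
    rcases lt_trichotomy i j with hij | rfl | hij
    · rw [if_neg hij.ne, sub_zero]
      exact hoff hij hj
    · rw [if_pos rfl]
      obtain ⟨r, hr1, hr2⟩ := MixedLSQR.lbfro_q_eq F A b N i
      rw [hr2]
      exact (h₁ (hu.trans (min_le_left _ _)) F r (hr1 ▸ (hNB i hi).1)).trans
        (mul_le_mul_of_nonneg_right (le_max_right _ _) hu0)
    · rw [if_neg hij.ne', sub_zero, dotProduct_comm]
      exact hoff hij hi
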